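/- Let $n\ge 2$ and let $\mathcal P=\mathcal Q(2n,3)$ be a parabolic (that is, nondegenerate) quadric in $\mathrm{PG}(2n,3)$. Call a hyperplane of $\mathrm{PG}(2n,3)$ elliptic, respectively hyperbolic, if it meets $\mathcal P$ in an elliptic quadric $\mathcal Q^-(2n-1,3)$, respectively a hyperbolic quadric $\mathcal Q^+(2n-1,3)$; these are the non-singular hyperplanes. A point is internal, respectively external, if its polar hyperplane with respect to $\mathcal P$ is elliptic, respectively hyperbolic. A parabolic quasi-quadric of $\mathrm{PG}(2n,3)$ is a set of points with the same intersection sizes with hyperplanes as a parabolic quadric. A set is obtained from $\mathcal P$ by switching in a hyperplane $\xi$ if it is $(\mathcal P\setminus R)\cup R'$ for a set $R$ of points of $\mathcal P\cap\xi$ and a set $R'$ of points of $\xi$. A quadric is the set of zeros of a nonzero, possibly degenerate, quadratic form. (a) Elliptic hyperplanes $\xi$ exist. Every elliptic hyperplane $\xi$ has hyperplanes $\pi$ that are singular (that is, $\mathcal P\cap\pi$ is a degenerate quadric of $\pi$). For every elliptic hyperplane $\xi$ and every such $\pi$, let $\mathcal P'$ be the set obtained from $\mathcal P$ by replacing the points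 of $\mathcal P$ in $\xi\setminus\pi$ by the internal points in $\xi\setminus\pi$. Then $\mathcal P'$ is obtained from $\mathcal P$ by switching in $\xi$, and $\mathcal P'$ is a parabolic quasi-quadric that is not a quadric. (b) The same holds with "elliptic hyperplane" replaced by "hyperbolic hyperplane" and "internal points" replaced by "external points". In particular, there exists a parabolic quasi-quadric which is not a quadric and which is obtained by switching $\mathcal Q(2n,3)$ in a non-singular hyperplane. -/

import Mathlib

open Module
open scoped LinearAlgebra.Projectivization

namespace QuasiPolar

/-- The point set of the subspace `W` of the projective space `PG(V)`. -/
def pointsOf {K V : Type*} [Field K] [AddCommGroup V] [Module K V]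
    (W : Submodule K V) : Set (ℙ K V) :=
  {p | p.submodule ≤ W}

/-- `W` is a hyperplane of the subspace `U`. -/
def IsHyperplaneOf {K V : Type*} [Field K] [AddCommGroup V] [Module K V]
    (W U : Submodule K V) : Prop :=
  W ≤ U ∧ finrank K W + 1 = finrank K U

/-- `H` is a hyperplane of the whole projective space `PG(V)`. -/
def IsHyperplane {K V : Type*} [Field K] [AddCommGroup V] [Module K V]
    (H : Submodule K V) : Prop :=
  IsHyperplaneOf H ⊤

/-- The quadric with equation `Q = 0`, as a set of projective points. -/
def quadric {K V : Type*} [Field K] [AddCommGroup V] [Module K V]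
    (Q : QuadraticForm K V) : Set (ℙ K V) :=
  {p | Q p.rep = 0}

/-- `S` is a quadric, possibly a degenerate one. -/
def IsQuadric {K V : Type*} [Field K] [AddCommGroup V] [Module K V]
    (S : Set (ℙ K V)) : Prop :=
  ∃ Q : QuadraticForm K V, Q ≠ 0 ∧ S = quadric Q

/-- The set of intersection sizes of `S` with the hyperplanes of `PG(V)`. -/
def hyperplaneSizes {K V : Type*} [Field K] [AddCommGroup V] [Module K V]
    (S : Set (ℙ K V)) : Set ℕ :=
  {k | ∃ H : Submodule K V, IsHyperplane H ∧ (S ∩ pointsOf H).ncard = k}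

/-- A parabolic quasi-quadric: a set of points of `PG(2n, q)`, `n ≥ 1`, with the same intersection
sizes with hyperplanes as a parabolic quadric `Q(2n, q)`. In even projective dimension (that is,
in odd vector space dimension) every nondegenerate quadric is parabolic. -/
def IsParabolicQuasiQuadric {K V : Type*} [Field K] [AddCommGroup V] [Module K V]
    (S : Set (ℙ K V)) : Prop :=
  3 ≤ finrank K V ∧ Odd (finrank K V) ∧
    ∃ Q : QuadraticForm K V, Q.Nondegenerate ∧ hyperplaneSizes S = hyperplaneSizes (quadric Q)

/-- `S'` arises from `S` by switching in `H`: a set `R` of points of `S` in `H` is replaced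
with a set `R'` of points of `H`. -/
def IsSwitching {K V : Type*} [Field K] [AddCommGroup V] [Module K V]
    (H : Submodule K V) (S S' : Set (ℙ K V)) : Prop :=
  ∃ R R' : Set (ℙ K V), R ⊆ S ∩ pointsOf H ∧ R' ⊆ pointsOf H ∧ S' = (S \ R) ∪ R'

/-- The subspace `U` is totally singular for `Q`: its points all lie on the quadric. -/
def IsTotallySingular {K V : Type*} [Field K] [AddCommGroup V] [Module K V]
    (Q : QuadraticForm K V) (U : Submodule K V) : Prop :=
  ∀ u ∈ U, Q u = 0

/-- A hyperbolic quadratic form: nondegenerate, of dimension `2m`, with a totally singular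
subspace of dimension `m`. -/
def IsHyperbolic {K V : Type*} [Field K] [AddCommGroup V] [Module K V]
    (Q : QuadraticForm K V) : Prop :=
  Q.Nondegenerate ∧ ∃ U : Submodule K V, IsTotallySingular Q U ∧ 2 * finrank K U = finrank K V

/-- An elliptic quadratic form over a finite field: nondegenerate, of dimension `2m`, without
totally singular subspaces of dimension `m`. -/
def IsElliptic {K V : Type*} [Field K] [AddCommGroup V] [Module K V]
    (Q : QuadraticForm K V) : Prop :=
  Q.Nondegenerate ∧ Even (finrank K V) ∧
    ¬ ∃ U : Submodule K V, IsTotallySingular Q U ∧ 2 * finrank K U = finrank K V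

/-- `H` is a hyperplane of `PG(V)` meeting the quadric `Q = 0` in an elliptic quadric. -/
def IsEllipticHyperplane {K V : Type*} [Field K] [AddCommGroup V] [Module K V]
    (Q : QuadraticForm K V) (H : Submodule K V) : Prop :=
  IsHyperplane H ∧ IsElliptic (Q.restrict H)

/-- `H` is a hyperplane of `PG(V)` meeting the quadric `Q = 0` in a hyperbolic quadric. -/
def IsHyperbolicHyperplane {K V : Type*} [Field K] [AddCommGroup V] [Module K V]
    (Q : QuadraticForm K V) (H : Submodule K V) : Prop :=
  IsHyperplane H ∧ IsHyperbolic (Q.restrict H)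

/-- `W` is a hyperplane of `U` that is singular with respect to the quadric `Q = 0`: the section
of the quadric with `W` is degenerate. -/
def IsSingularHyperplaneOf {K V : Type*} [Field K] [AddCommGroup V] [Module K V]
    (Q : QuadraticForm K V) (W U : Submodule K V) : Prop :=
  IsHyperplaneOf W U ∧ ¬ (Q.restrict W).Nondegenerate

/-- The polar space `p^⊥` of the point `p`. -/
noncomputable def polarSpace {K V : Type*} [Field K] [AddCommGroup V] [Module K V]
    (Q : QuadraticForm K V) (p : ℙ K V) : Submodule K V :=
  LinearMap.ker (Q.polarBilin p.rep)

/-- The internal points of a parabolic quadric, in odd characteristic: the points whose polar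
hyperplane meets the quadric in an elliptic quadric. -/
def internalPoints {K V : Type*} [Field K] [AddCommGroup V] [Module K V]
    (Q : QuadraticForm K V) : Set (ℙ K V) :=
  {p | IsEllipticHyperplane Q (polarSpace Q p)}

/-- The external points of a parabolic quadric, in odd characteristic: the points whose polar
hyperplane meets the quadric in a hyperbolic quadric. -/
def externalPoints {K V : Type*} [Field K] [AddCommGroup V] [Module K V]
    (Q : QuadraticForm K V) : Set (ℙ K V) :=
  {p | IsHyperbolicHyperplane Q (polarSpace Q p)}

/-- The set obtained from `S` by replacing its points in `ξ ∖ π` by the points of `X` in `ξ ∖ π`. -/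
def replaceOutside {K V : Type*} [Field K] [AddCommGroup V] [Module K V]
    (S X : Set (ℙ K V)) (ξ π : Submodule K V) : Set (ℙ K V) :=
  (S \ (pointsOf ξ \ pointsOf π)) ∪ (X ∩ (pointsOf ξ \ pointsOf π))

end QuasiPolar

namespace QuasiPolar

open QuadraticMap (polar)

variable {V : Type*} [AddCommGroup V] [Module (ZMod 3) V]

/-! Nonzero scalars of F_3 square to 1, so Q has a well-defined value in F_3 at every projective
point. Write ξ = u^⊥ with Q(u) ≠ 0, and let ε be the sign of ξ (1 hyperbolic, -1 elliptic). Counting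
the vectors of a given value shows that h^⊥ with Q(h) ≠ 0 has sign ε exactly when Q(h) = Q(u)
(`HasSign.of_perp_of_perp`). Hence the points that enter are those with Q = Q(u), and both cases
become one statement about ε. A singular π is ξ ∩ r^⊥ with r a singular vector of ξ, so on ξ \ r^⊥
the condition Q = 0 is replaced with Q = Q(u) (`SwitchedCone`).

Hyperplane sizes are compared through vector counts; `HasSign` carries a factor 3 so that its
formula has no fractions, even in dimension 0. If h^⊥ contains r, translation along r
equidistributes the values of Q on (ξ ∩ h^⊥) \ r^⊥, so nothing changes. Otherwise ξ ∩ h^⊥ is the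
orthogonal sum of a line and a space M of dimension 2n - 2 and sign ε, which gives the exact change
(`switchedCount_of_polar_eq_one`). A finite check over F_3 then shows that the new size is one of
the three sizes for the quadric (`switchedCount_perp_top`). All three still occur: at r^⊥, at u^⊥,
and at s^⊥ for a singular s in ξ not orthogonal to r.

The switched set is not a quadric because some line meets it in exactly three of its four points,
whereas a quadratic form vanishing at three points of a line vanishes on the whole line
(`not_isQuadric_switched`). -/

/-- The subspace of `W` orthogonal to `e`. -/
noncomputable def perp (Q : QuadraticForm (ZMod 3) V) (W : Submodule (ZMod 3) V) (e : V) :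
    Submodule (ZMod 3) V :=
  W ⊓ LinearMap.ker (Q.polarBilin e)

/-- The polar form of `Q` is nondegenerate on `W`. -/
def NondegenerateOn (Q : QuadraticForm (ZMod 3) V) (W : Submodule (ZMod 3) V) : Prop :=
  ∀ x ∈ W, (∀ y ∈ W, polar Q x y = 0) → x = 0

/-- The number of vectors of `W` on which `Q` takes the value `c`. -/
noncomputable def count (Q : QuadraticForm (ZMod 3) V) (W : Submodule (ZMod 3) V) (c : ZMod 3) :
    ℕ :=
  Nat.card {x : V // x ∈ W ∧ Q x = c}

/-- The number of vectors of `W` on which `f` takes the value `t` and `Q` the value `c`. -/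
noncomputable def countFiber (Q : QuadraticForm (ZMod 3) V) (W : Submodule (ZMod 3) V)
    (f : V →ₗ[ZMod 3] ZMod 3) (t c : ZMod 3) : ℕ :=
  Nat.card {x : V // x ∈ W ∧ f x = t ∧ Q x = c}

variable {Q : QuadraticForm (ZMod 3) V} {W : Submodule (ZMod 3) V}

/-! ### Identities over the field with three elements -/

theorem mem_perp {e x : V} : x ∈ perp Q W e ↔ x ∈ W ∧ polar Q e x = 0 := by
  simp [perp]

theorem perp_le (e : V) : perp Q W e ≤ W := inf_le_left

theorem polar_self_eq (x : V) : polar Q x x = 2 * Q x := by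
  rw [QuadraticMap.polar_self, nsmul_eq_mul, Nat.cast_ofNat]

theorem map_add_smul (x y : V) (t : ZMod 3) :
    Q (x + t • y) = Q x + t * t * Q y + t * polar Q x y := by
  rw [QuadraticMap.map_add Q, QuadraticMap.map_smul, QuadraticMap.polar_smul_right, smul_eq_mul,
    smul_eq_mul]

theorem polar_add_smul (x y z : V) (t : ZMod 3) :
    polar Q x (y + t • z) = polar Q x y + t * polar Q x z := by
  rw [QuadraticMap.polar_add_right, QuadraticMap.polar_smul_right, smul_eq_mul]

theorem mul_self_of_ne_zero {t : ZMod 3} (ht : t ≠ 0) : t * t = 1 := by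
  revert t; decide

theorem sum_zmod_three {M : Type*} [AddCommMonoid M] (g : ZMod 3 → M) :
    ∑ t, g t = g 0 + g 1 + g 2 :=
  Fin.sum_univ_three g

theorem finrank_inf_ker [Finite V] (f : V →ₗ[ZMod 3] ZMod 3) {x : V} (hx : x ∈ W) (hf : f x ≠ 0) :
    finrank (ZMod 3) ↥(W ⊓ LinearMap.ker f) + 1 = finrank (ZMod 3) W := by
  have h1 := LinearMap.finrank_range_add_finrank_ker (f.domRestrict W)
  have h2 : LinearMap.range (f.domRestrict W) = ⊤ := by
    apply LinearMap.range_eq_top.2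
    apply LinearMap.surjective
    intro h
    exact hf (LinearMap.congr_fun h ⟨x, hx⟩)
  have h3 : finrank (ZMod 3) (LinearMap.ker (f.domRestrict W))
      = finrank (ZMod 3) ↥(W ⊓ LinearMap.ker f) := by
    have h4 : W ⊓ LinearMap.ker f = (LinearMap.ker (f.domRestrict W)).map W.subtype := by
      ext y
      simp [and_comm]
    rw [h4]
    exact (LinearEquiv.finrank_eq (Submodule.equivMapOfInjective _ W.subtype_injective _))
  rw [h2, finrank_top, finrank_self, h3] at h1
  omega

theorem finrank_perp [Finite V] {e x : V} (hx : x ∈ W) (h : polar Q e x ≠ 0) :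
    finrank (ZMod 3) (perp Q W e) + 1 = finrank (ZMod 3) W :=
  finrank_inf_ker (Q.polarBilin e) hx h

/-! ### Orthogonal decompositions -/

theorem NondegenerateOn.perp_of_ne_zero (hW : NondegenerateOn Q W) {e : V} (he : e ∈ W)
    (hQ : Q e ≠ 0) : NondegenerateOn Q (perp Q W e) := by
  intro x hx h
  rw [mem_perp] at hx
  refine hW x hx.1 fun y hy => ?_
  -- Projection of y to e^⊥: over F_3 the usual coefficient -B(e,y)/(2Q(e)) equals Q(e)B(e,y).
  have h1 := h (y + (Q e * polar Q e y) • e) (mem_perp.2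
    ⟨W.add_mem hy (W.smul_mem _ he), by
      rw [polar_add_smul, polar_self_eq]
      generalize polar Q e y = t
      generalize Q e = a at *
      decide +revert⟩)
  rwa [polar_add_smul, QuadraticMap.polar_comm Q x e, hx.2, mul_zero, add_zero] at h1

theorem NondegenerateOn.perp_perp (hW : NondegenerateOn Q W) {r s : V} (hr : r ∈ W) (hs : s ∈ W)
    (hQr : Q r = 0) (hQs : Q s = 0) (hrs : polar Q r s = 1) :
    NondegenerateOn Q (perp Q (perp Q W r) s) := by
  intro x hx h
  rw [mem_perp, mem_perp] at hx
  refine hW x hx.1.1 fun y hy => ?_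
  have hsr : polar Q s r = 1 := by rw [QuadraticMap.polar_comm, hrs]
  have h1 := h (y + (-polar Q s y) • r + (-polar Q r y) • s) (by
    rw [mem_perp, mem_perp]
    refine ⟨⟨W.add_mem (W.add_mem hy (W.smul_mem _ hr)) (W.smul_mem _ hs), ?_⟩, ?_⟩
    · rw [polar_add_smul, polar_add_smul, polar_self_eq, hQr, hrs]; ring
    · rw [polar_add_smul, polar_add_smul, polar_self_eq, hQs, hsr]; ring)
  rwa [polar_add_smul, polar_add_smul, QuadraticMap.polar_comm Q x r, QuadraticMap.polar_comm Q x s,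
    hx.1.2, hx.2, mul_zero, mul_zero, add_zero, add_zero] at h1

theorem exists_polar_eq_one {r y : V} (hy : y ∈ W) (h : polar Q r y ≠ 0) :
    ∃ s ∈ W, polar Q r s = 1 := by
  refine ⟨polar Q r y • y, W.smul_mem _ hy, ?_⟩
  rw [QuadraticMap.polar_smul_right, smul_eq_mul, mul_self_of_ne_zero h]

/-- Adding a multiple of the singular vector r to s keeps B(r,s) = 1 and shifts Q(s) by that
multiple. -/
theorem exists_polar_eq_one_map_eq {r y : V} (hr : r ∈ W) (hQr : Q r = 0) (hy : y ∈ W)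
    (h : polar Q r y ≠ 0) (c : ZMod 3) : ∃ s ∈ W, polar Q r s = 1 ∧ Q s = c := by
  obtain ⟨s, hs, hrs⟩ := exists_polar_eq_one hy h
  refine ⟨s + (c - Q s) • r, W.add_mem hs (W.smul_mem _ hr), ?_, ?_⟩
  · rw [polar_add_smul, polar_self_eq, hQr, hrs]; ring
  · rw [map_add_smul, QuadraticMap.polar_comm, hQr, hrs]; ring

theorem NondegenerateOn.exists_polar_ne_zero (hW : NondegenerateOn Q W) {r : V} (hr : r ∈ W)
    (h0 : r ≠ 0) : ∃ y ∈ W, polar Q r y ≠ 0 := by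
  by_contra! h
  exact h0 (hW r hr h)

theorem NondegenerateOn.exists_map_ne_zero (hW : NondegenerateOn Q W)
    (h : 1 ≤ finrank (ZMod 3) W) : ∃ e ∈ W, Q e ≠ 0 := by
  by_contra! hQ
  have hbot : W = ⊥ := by
    rw [eq_bot_iff]
    intro x hx
    refine hW x hx fun y hy => ?_
    rw [QuadraticMap.polar, hQ _ hx, hQ _ hy, hQ _ (W.add_mem hx hy)]; ring
  rw [hbot, finrank_bot] at h
  omega

theorem finrank_perp_add_one [Finite V] {e : V} (he : e ∈ W) (hQ : Q e ≠ 0) :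
    finrank (ZMod 3) (perp Q W e) + 1 = finrank (ZMod 3) W := by
  refine finrank_perp he ?_
  rw [polar_self_eq]
  generalize Q e = a at *
  decide +revert

/-- Two orthogonal anisotropic vectors. -/
theorem NondegenerateOn.exists_orthogonal_pair [Finite V] (hW : NondegenerateOn Q W)
    (h : 2 ≤ finrank (ZMod 3) W) :
    ∃ e ∈ W, Q e ≠ 0 ∧ ∃ f ∈ perp Q W e, Q f ≠ 0 := by
  obtain ⟨e, he, hQe⟩ := hW.exists_map_ne_zero (by omega)
  have h1 := finrank_perp_add_one he hQe
  obtain ⟨f, hf, hQf⟩ := (hW.perp_of_ne_zero he hQe).exists_map_ne_zero (by omega)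
  exact ⟨e, he, hQe, f, hf, hQf⟩

theorem NondegenerateOn.exists_isotropic [Finite V] (hW : NondegenerateOn Q W)
    (h : 3 ≤ finrank (ZMod 3) W) : ∃ r ∈ W, r ≠ 0 ∧ Q r = 0 := by
  obtain ⟨e, he, hQe⟩ := hW.exists_map_ne_zero (by omega)
  have h1 := finrank_perp_add_one he hQe
  obtain ⟨f, hf, hQf, g, hg, hQg⟩ :=
    (hW.perp_of_ne_zero he hQe).exists_orthogonal_pair (by omega)
  rw [mem_perp, mem_perp] at hg
  rw [mem_perp] at hf
  have hne : ∀ t k : ZMod 3, e + t • f + k • g ≠ 0 := by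
    intro t k h0
    have h2 : polar Q e (e + t • f + k • g) = 0 := by rw [h0, QuadraticMap.polar_zero_right]
    rw [polar_add_smul, polar_add_smul, hf.2, hg.1.2, polar_self_eq, mul_zero,
      mul_zero, add_zero, add_zero] at h2
    revert hQe h2
    generalize Q e = a
    clear * -
    decide +revert
  have hval : ∀ t k : ZMod 3, Q (e + t • f + k • g) = Q e + t * t * Q f + k * k * Q g := by
    intro t k
    rw [map_add_smul, map_add_smul, hf.2, QuadraticMap.polar_comm, polar_add_smul,
      QuadraticMap.polar_comm Q g f, QuadraticMap.polar_comm Q g e, hg.2, hg.1.2]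
    ring
  have hmem : ∀ t k : ZMod 3, e + t • f + k • g ∈ W := fun t k =>
    W.add_mem (W.add_mem he (W.smul_mem _ hf.1)) (W.smul_mem _ hg.1.1)
  -- Of three nonzero values a, b, c, either b or c equals -a, or all three are equal and a + b + c
  -- = 3a = 0.
  obtain ⟨t, k, htk⟩ : ∃ t k : ZMod 3, Q e + t * t * Q f + k * k * Q g = 0 := by
    generalize Q e = a at *
    generalize Q f = b at *
    generalize Q g = c at *
    clear * - hQe hQf hQg
    decide +revert
  exact ⟨_, hmem t k, hne t k, (hval t k).trans htk⟩

theorem NondegenerateOn.exists_map_eq [Finite V] (hW : NondegenerateOn Q W)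
    (h : 3 ≤ finrank (ZMod 3) W) (c : ZMod 3) : ∃ x ∈ W, x ≠ 0 ∧ Q x = c := by
  obtain ⟨r, hr, hr0, hQr⟩ := hW.exists_isotropic h
  obtain ⟨y, hy, hry⟩ := hW.exists_polar_ne_zero hr hr0
  obtain ⟨s, hs, hrs, hQs⟩ := exists_polar_eq_one_map_eq hr hQr hy hry c
  refine ⟨s, hs, ?_, hQs⟩
  rintro rfl
  simp at hrs

/-! ### Counting -/

theorem count_sum [Finite V] :
    count Q W 0 + count Q W 1 + count Q W 2 = 3 ^ finrank (ZMod 3) W := by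
  rw [← sum_zmod_three (count Q W)]
  have h1 : Nat.card W = 3 ^ finrank (ZMod 3) W := by
    rw [Module.natCard_eq_pow_finrank (K := ZMod 3), Nat.card_zmod]
  rw [← h1, ← Nat.card_congr (Equiv.sigmaFiberEquiv (fun x : W => Q x)), Nat.card_sigma]
  exact Finset.sum_congr rfl fun c _ =>
    Nat.card_congr (Equiv.subtypeSubtypeEquivSubtypeInter (· ∈ W) (fun x => Q x = c)).symm

theorem count_eq_sum_countFiber [Finite V] (f : V →ₗ[ZMod 3] ZMod 3) (c : ZMod 3) :
    count Q W c = countFiber Q W f 0 c + countFiber Q W f 1 c + countFiber Q W f 2 c := by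
  rw [← sum_zmod_three (fun t => countFiber Q W f t c), count,
    ← Nat.card_congr (Equiv.sigmaFiberEquiv (fun x : {x : V // x ∈ W ∧ Q x = c} => f x)),
    Nat.card_sigma]
  refine Finset.sum_congr rfl fun t _ => ?_
  refine Nat.card_congr ((Equiv.subtypeSubtypeEquivSubtypeInter (fun x => x ∈ W ∧ Q x = c)
    (fun x => f x = t)).trans (Equiv.subtypeEquivRight fun x => ?_))
  tauto

theorem countFiber_zero (f : V →ₗ[ZMod 3] ZMod 3) (c : ZMod 3) :
    countFiber Q W f 0 c = count Q (W ⊓ LinearMap.ker f) c := by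
  refine Nat.card_congr (Equiv.subtypeEquivRight fun x => ?_)
  simp [and_assoc]

/-- Translation by a multiple of `e` identifies the fibres of `f`, if `e` is orthogonal to
the kernel of `f` in `W`. -/
theorem countFiber_eq {f : V →ₗ[ZMod 3] ZMod 3} {e : V} (he : e ∈ W) (hfe : f e = 1)
    (h : ∀ m ∈ W, f m = 0 → polar Q m e = 0) (t c : ZMod 3) :
    countFiber Q W f t c = count Q (W ⊓ LinearMap.ker f) (c - t * t * Q e) := by
  refine Nat.card_congr ((Equiv.addRight (-(t • e))).subtypeEquiv fun x => ?_)
  simp only [Equiv.coe_addRight, Submodule.mem_inf, LinearMap.mem_ker, ← sub_eq_add_neg]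
  have hW : x - t • e ∈ W ↔ x ∈ W := W.sub_mem_iff_left (W.smul_mem _ he)
  rw [hW, map_sub, map_smul, hfe, smul_eq_mul, mul_one, sub_eq_zero, and_assoc]
  refine and_congr_right fun hx => and_congr_right fun hft => ?_
  have h1 : polar Q (x - t • e) e = 0 := h _ (hW.2 hx) (by simp [hft, hfe])
  have h2 := map_add_smul (Q := Q) (x - t • e) e t
  rw [sub_add_cancel, h1, mul_zero, add_zero] at h2
  rw [h2, eq_sub_iff_add_eq]

/-- Off the hyperplane orthogonal to an isotropic vector, all values are taken equally often. -/
theorem countFiber_isotropic {r : V} (hr : r ∈ W) (hQr : Q r = 0) {t : ZMod 3} (ht : t ≠ 0)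
    (c d : ZMod 3) : countFiber Q W (Q.polarBilin r) t c = countFiber Q W (Q.polarBilin r) t d := by
  refine Nat.card_congr ((Equiv.addRight ((t * (d - c)) • r)).subtypeEquiv fun x => ?_)
  simp only [Equiv.coe_addRight, QuadraticMap.polarBilin_apply_apply]
  rw [W.add_mem_iff_left (W.smul_mem _ hr), polar_add_smul, polar_self_eq, map_add_smul, hQr,
    QuadraticMap.polar_comm Q x r, mul_zero, mul_zero, mul_zero, add_zero, add_zero]
  refine and_congr_right fun hx => and_congr_right fun hft => ?_
  rw [hft, show t * (d - c) * t = t * t * (d - c) by ring, mul_self_of_ne_zero ht, one_mul]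
  constructor
  · rintro rfl; ring
  · intro h; linear_combination h

/-- The vectors of W outside r^⊥ number twice those inside, and they are spread evenly over the
three values. -/
theorem count_of_isotropic [Finite V] {r y : V} (hr : r ∈ W) (hQr : Q r = 0) (hy : y ∈ W)
    (h : polar Q r y ≠ 0) (c : ZMod 3) :
    3 * count Q W c = 3 * count Q (perp Q W r) c + 2 * 3 ^ finrank (ZMod 3) (perp Q W r) := by
  have key : ∀ c, count Q W c = count Q (perp Q W r) c
      + (countFiber Q W (Q.polarBilin r) 1 0 + countFiber Q W (Q.polarBilin r) 2 0) := fun c => by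
    rw [count_eq_sum_countFiber (Q.polarBilin r), countFiber_zero,
      countFiber_isotropic hr hQr (by decide : (1 : ZMod 3) ≠ 0) c 0,
      countFiber_isotropic hr hQr (by decide : (2 : ZMod 3) ≠ 0) c 0, add_assoc, perp]
  have h1 := count_sum (Q := Q) (W := W)
  have h2 := count_sum (Q := Q) (W := perp Q W r)
  rw [← finrank_perp hy h, pow_succ] at h1
  have k0 := key 0
  have k1 := key 1
  have k2 := key 2
  have kc := key c
  omega

theorem count_of_anisotropic [Finite V] {e : V} (he : e ∈ W) (hQ : Q e ≠ 0) (c : ZMod 3) :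
    count Q W c = count Q (perp Q W e) c + 2 * count Q (perp Q W e) (c - Q e) := by
  -- The factor makes f(e) = -2Q(e)² = 1, so that translation by t • e identifies the fibres with
  -- e^⊥.
  set f : V →ₗ[ZMod 3] ZMod 3 := (-Q e) • Q.polarBilin e with hf
  have hfe : f e = 1 := by
    simp only [hf, LinearMap.smul_apply, QuadraticMap.polarBilin_apply_apply, polar_self_eq,
      smul_eq_mul]
    generalize Q e = a at *
    clear * - hQ
    decide +revert
  have hker : W ⊓ LinearMap.ker f = perp Q W e := by
    rw [hf, LinearMap.ker_smul _ _ (neg_ne_zero.2 hQ), perp]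
  have h : ∀ m ∈ W, f m = 0 → polar Q m e = 0 := fun m hm h0 => by
    have : m ∈ perp Q W e := hker ▸ ⟨hm, h0⟩
    rw [QuadraticMap.polar_comm, (mem_perp.1 this).2]
  rw [count_eq_sum_countFiber f, countFiber_eq he hfe h, countFiber_eq he hfe h,
    countFiber_eq he hfe h, hker]
  have e0 : c - 0 * 0 * Q e = c := by ring
  have e1 : c - 1 * 1 * Q e = c - Q e := by ring
  have e2 : c - 2 * 2 * Q e = c - Q e := by
    generalize Q e = a
    clear * -
    decide +revert
  rw [e0, e1, e2]
  ring

theorem count_of_hyperbolic_pair [Finite V] {r s : V} (hr : r ∈ W) (hs : s ∈ W) (hQr : Q r = 0)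
    (hrs : polar Q r s = 1) (c : ZMod 3) :
    count Q W c = 3 * count Q (perp Q (perp Q W r) s) c
      + 2 * 3 ^ finrank (ZMod 3) (perp Q (perp Q W r) s) := by
  have hr' : r ∈ perp Q W r := mem_perp.2 ⟨hr, by rw [polar_self_eq, hQr, mul_zero]⟩
  have hsr : Q.polarBilin s r = 1 := by
    rw [QuadraticMap.polarBilin_apply_apply, QuadraticMap.polar_comm, hrs]
  have h : ∀ m ∈ perp Q W r, Q.polarBilin s m = 0 → polar Q m r = 0 := fun m hm _ => by
    rw [QuadraticMap.polar_comm, (mem_perp.1 hm).2]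
  have h1 := count_of_isotropic hr hQr hs (by rw [hrs]; decide) c
  have h2 : count Q (perp Q W r) c = 3 * count Q (perp Q (perp Q W r) s) c := by
    rw [count_eq_sum_countFiber (Q.polarBilin s), countFiber_eq hr' hsr h,
      countFiber_eq hr' hsr h, countFiber_eq hr' hsr h, hQr, mul_zero, mul_zero, mul_zero, sub_zero,
      ← perp]
    ring
  have h3 : finrank (ZMod 3) (perp Q (perp Q W r) s) + 1 = finrank (ZMod 3) (perp Q W r) :=
    finrank_perp hr' (by rw [QuadraticMap.polar_comm, hrs]; decide)
  rw [← h3, h2, pow_succ] at h1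
  omega

/-! ### The sign of an even-dimensional form -/

/-- `W` has dimension `2 * m` and the value distribution of a nondegenerate form of sign `ε`. -/
def HasSign (Q : QuadraticForm (ZMod 3) V) (W : Submodule (ZMod 3) V) (m : ℕ) (ε : ℤ) : Prop :=
  finrank (ZMod 3) W = 2 * m ∧
    ∀ c, 3 * (count Q W c : ℤ) = 9 ^ m + ε * 3 ^ m * (if c = 0 then 2 else -1)

/-- `W` has a totally singular subspace of half its dimension. -/
def HasHalfSingular (Q : QuadraticForm (ZMod 3) V) (W : Submodule (ZMod 3) V) : Prop :=
  ∃ U ≤ W, IsTotallySingular Q U ∧ 2 * finrank (ZMod 3) U = finrank (ZMod 3) W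

theorem HasSign.unique {m : ℕ} {ε ε' : ℤ} (h : HasSign Q W m ε) (h' : HasSign Q W m ε') :
    ε = ε' := by
  have h1 := (h.2 0).symm.trans (h'.2 0)
  simp only [if_true] at h1
  have h3 : (3 : ℤ) ^ m ≠ 0 := by positivity
  have h4 : (ε - ε') * 3 ^ m = 0 := by linarith
  rcases mul_eq_zero.1 h4 with h5 | h5
  · omega
  · exact absurd h5 h3

theorem finrank_perp_perp [Finite V] {r s : V} (hr : r ∈ W) (hs : s ∈ W) (hQr : Q r = 0)
    (hrs : polar Q r s = 1) :
    finrank (ZMod 3) (perp Q (perp Q W r) s) + 2 = finrank (ZMod 3) W := by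
  have hr' : r ∈ perp Q W r := mem_perp.2 ⟨hr, by rw [polar_self_eq, hQr, mul_zero]⟩
  have h1 : finrank (ZMod 3) (perp Q W r) + 1 = finrank (ZMod 3) W :=
    finrank_perp hs (by rw [hrs]; decide)
  have h3 : finrank (ZMod 3) (perp Q (perp Q W r) s) + 1 = finrank (ZMod 3) (perp Q W r) :=
    finrank_perp hr' (by rw [QuadraticMap.polar_comm, hrs]; decide)
  omega

/-- Splitting off a hyperbolic plane divides by 3 the deviation of the counts from equidistribution,
so the sign persists. -/
theorem hasSign_perp_perp_iff [Finite V] {r s : V} (hr : r ∈ W) (hs : s ∈ W) (hQr : Q r = 0)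
    (hrs : polar Q r s = 1) {m : ℕ} {ε : ℤ} :
    HasSign Q (perp Q (perp Q W r) s) m ε ↔ HasSign Q W (m + 1) ε := by
  have h1 := finrank_perp_perp hr hs hQr hrs
  have h2 := count_of_hyperbolic_pair (Q := Q) hr hs hQr hrs
  have h3 : finrank (ZMod 3) (perp Q (perp Q W r) s) = 2 * m ↔
      finrank (ZMod 3) W = 2 * (m + 1) := by omega
  unfold HasSign
  rw [h3]
  refine and_congr_right fun hm => forall_congr' fun c => ?_
  have h4 : finrank (ZMod 3) (perp Q (perp Q W r) s) = 2 * m := by omega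
  rw [h2 c, h4, pow_mul]
  push_cast
  rw [pow_succ, pow_succ]
  generalize (if c = 0 then (2 : ℤ) else -1) = d
  constructor <;> intro h <;> linarith

theorem exists_hyperbolic_partner (hW : NondegenerateOn Q W) {r : V} (hr : r ∈ W) (h0 : r ≠ 0)
    (hQr : Q r = 0) : ∃ s ∈ W, polar Q r s = 1 ∧ Q s = 0 := by
  obtain ⟨y, hy, hry⟩ := hW.exists_polar_ne_zero hr h0
  exact exists_polar_eq_one_map_eq hr hQr hy hry 0

theorem IsTotallySingular.polar_eq_zero {U : Submodule (ZMod 3) V} (hU : IsTotallySingular Q U)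
    {x y : V} (hx : x ∈ U) (hy : y ∈ U) : polar Q x y = 0 := by
  rw [QuadraticMap.polar, hU _ hx, hU _ hy, hU _ (U.add_mem hx hy)]; ring

theorem hasSign_bot [Finite V] (h : finrank (ZMod 3) W = 0) : HasSign Q W 0 1 := by
  refine ⟨by omega, fun c => ?_⟩
  have hW : W = ⊥ := Submodule.finrank_eq_zero.1 h
  have hc : count Q W c = if c = 0 then 1 else 0 := by
    unfold count
    split_ifs with h0
    · have : Unique {x : V // x ∈ W ∧ Q x = c} :=
        ⟨⟨⟨0, W.zero_mem, by simp [h0]⟩⟩, fun x => Subtype.ext (by simpa [hW] using x.2.1)⟩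
      exact Nat.card_unique
    · have : IsEmpty {x : V // x ∈ W ∧ Q x = c} := by
        refine ⟨fun x => h0 ?_⟩
        have h1 : x.1 = 0 := by simpa [hW] using x.2.1
        rw [← x.2.2, h1, QuadraticMap.map_zero]
      exact Nat.card_of_isEmpty
  rw [hc]
  split_ifs <;> norm_num

theorem NondegenerateOn.hasSign_one [Finite V] (hW : NondegenerateOn Q W)
    (h : HasHalfSingular Q W) {m : ℕ} (hm : finrank (ZMod 3) W = 2 * m) : HasSign Q W m 1 := by
  induction m generalizing W with
  | zero => exact hasSign_bot (by omega)
  | succ m ih =>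
    obtain ⟨U, hUW, hU, hd⟩ := h
    have hU0 : U ≠ ⊥ := by
      rintro rfl
      rw [finrank_bot] at hd
      omega
    obtain ⟨r, hrU, hr0⟩ := U.ne_bot_iff.1 hU0
    obtain ⟨s, hs, hrs, hQs⟩ := exists_hyperbolic_partner hW (hUW hrU) hr0 (hU r hrU)
    have h1 := finrank_perp_perp (hUW hrU) hs (hU r hrU) hrs
    refine (hasSign_perp_perp_iff (hUW hrU) hs (hU r hrU) hrs).1 (ih
      (hW.perp_perp (hUW hrU) hs (hU r hrU) hQs hrs) ⟨perp Q U s, ?_, ?_, ?_⟩ (by omega))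
    · intro x hx
      rw [mem_perp] at hx
      exact mem_perp.2 ⟨mem_perp.2 ⟨hUW hx.1, hU.polar_eq_zero hrU hx.1⟩, hx.2⟩
    · exact fun x hx => hU x (perp_le s hx)
    · have h2 : finrank (ZMod 3) (perp Q U s) + 1 = finrank (ZMod 3) U :=
        finrank_perp hrU (by rw [QuadraticMap.polar_comm, hrs]; decide)
      omega

theorem hasHalfSingular_of_perp_perp [Finite V] {r s : V} (hr : r ∈ W) (hs : s ∈ W)
    (hQr : Q r = 0) (hrs : polar Q r s = 1)
    (h : HasHalfSingular Q (perp Q (perp Q W r) s)) : HasHalfSingular Q W := by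
  obtain ⟨U, hUM, hU, hd⟩ := h
  have h1 := finrank_perp_perp hr hs hQr hrs
  have hM : ∀ x ∈ U, x ∈ W ∧ polar Q r x = 0 ∧ polar Q s x = 0 := fun x hx => by
    have := hUM hx
    rw [mem_perp, mem_perp] at this
    tauto
  have hsr : polar Q s r = 1 := by rw [QuadraticMap.polar_comm, hrs]
  refine ⟨U ⊔ Submodule.span (ZMod 3) {r}, ?_, ?_, ?_⟩
  · refine sup_le (fun x hx => (hM x hx).1) ?_
    rw [Submodule.span_singleton_le_iff_mem]
    exact hr
  · intro x hx
    obtain ⟨y, hy, z, hz, rfl⟩ := Submodule.mem_sup.1 hx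
    obtain ⟨t, rfl⟩ := Submodule.mem_span_singleton.1 hz
    rw [map_add_smul, hU y hy, hQr, QuadraticMap.polar_comm, (hM y hy).2.1]
    ring
  · have h2 : perp Q (U ⊔ Submodule.span (ZMod 3) {r}) s = U := by
      ext x
      rw [mem_perp]
      constructor
      · rintro ⟨hx, hx0⟩
        obtain ⟨y, hy, z, hz, rfl⟩ := Submodule.mem_sup.1 hx
        obtain ⟨t, rfl⟩ := Submodule.mem_span_singleton.1 hz
        rw [polar_add_smul, (hM y hy).2.2, hsr] at hx0
        have ht : t = 0 := by simpa using hx0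
        simpa [ht] using hy
      · exact fun hx => ⟨Submodule.mem_sup_left hx, (hM x hx).2.2⟩
    have h3 := finrank_perp (Q := Q) (W := U ⊔ Submodule.span (ZMod 3) {r}) (e := s) (x := r)
      (Submodule.mem_sup_right (Submodule.mem_span_singleton_self r)) (by rw [hsr]; decide)
    rw [h2] at h3
    omega

theorem NondegenerateOn.hasSign_neg_one_of_finrank_eq_two [Finite V] (hW : NondegenerateOn Q W)
    (h : ¬ HasHalfSingular Q W) (hm : finrank (ZMod 3) W = 2) : HasSign Q W 1 (-1) := by
  have haniso : ∀ x ∈ W, x ≠ 0 → Q x ≠ 0 := by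
    intro x hx hx0 hQx
    refine h ⟨Submodule.span (ZMod 3) {x}, ?_, ?_, ?_⟩
    · rw [Submodule.span_singleton_le_iff_mem]
      exact hx
    · intro y hy
      obtain ⟨t, rfl⟩ := Submodule.mem_span_singleton.1 hy
      rw [QuadraticMap.map_smul, hQx, smul_zero]
    · rw [finrank_span_singleton hx0, hm]
  obtain ⟨e, he, hQe, f, hf, hQf⟩ := hW.exists_orthogonal_pair (by omega)
  have hd1 := finrank_perp_add_one he hQe
  have hd2 := finrank_perp_add_one hf hQf
  -- If Q(f) = -Q(e), then e + f would be a nonzero singular vector, spanning half of the plane.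
  have hef : Q f = Q e := by
    have h1 : Q (e + (1 : ZMod 3) • f) ≠ 0 := by
      rw [mem_perp] at hf
      refine haniso _ (W.add_mem he (W.smul_mem _ hf.1)) fun h0 => ?_
      have h2 : polar Q e (e + (1 : ZMod 3) • f) = 0 := by
        rw [h0, QuadraticMap.polar_zero_right]
      rw [polar_add_smul, hf.2, polar_self_eq, mul_zero, add_zero] at h2
      revert h2 hQe
      generalize Q e = a
      clear * -
      decide +revert
    rw [map_add_smul, (mem_perp.1 hf).2] at h1
    revert h1 hQe hQf
    generalize Q e = a
    generalize Q f = b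
    clear * -
    decide +revert
  have h0 := hasSign_bot (Q := Q) (W := perp Q (perp Q W e) f) (by omega)
  refine ⟨by omega, fun c => ?_⟩
  rw [count_of_anisotropic he hQe, count_of_anisotropic hf hQf, count_of_anisotropic hf hQf, hef]
  have k0 := h0.2 c
  have k1 := h0.2 (c - Q e)
  have k2 := h0.2 (c - Q e - Q e)
  push_cast
  revert k0 k1 k2 hQe
  generalize Q e = a
  intro ha k0 k1 k2
  have : 3 * ((count Q (perp Q (perp Q W e) f) c : ℤ)
      + 2 * count Q (perp Q (perp Q W e) f) (c - a)
      + 2 * (count Q (perp Q (perp Q W e) f) (c - a)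
        + 2 * count Q (perp Q (perp Q W e) f) (c - a - a)))
      = (9 ^ 0 + 1 * 3 ^ 0 * (if c = 0 then 2 else -1))
        + 4 * (9 ^ 0 + 1 * 3 ^ 0 * (if c - a = 0 then 2 else -1))
        + 4 * (9 ^ 0 + 1 * 3 ^ 0 * (if c - a - a = 0 then 2 else -1)) := by
    linarith
  rw [this]
  clear * - ha
  decide +revert

theorem NondegenerateOn.hasSign_neg_one [Finite V] (hW : NondegenerateOn Q W)
    (h : ¬ HasHalfSingular Q W) {m : ℕ} (hm : finrank (ZMod 3) W = 2 * m) :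
    HasSign Q W m (-1) := by
  induction m generalizing W with
  | zero =>
    -- In dimension 0 the zero subspace is half-dimensional, so the negative sign starts at m = 1.
    refine absurd ⟨⊥, bot_le, ?_, ?_⟩ h
    · intro u hu
      rw [(Submodule.mem_bot _).1 hu, QuadraticMap.map_zero]
    · rw [finrank_bot]
      omega
  | succ m ih =>
    rcases Nat.eq_zero_or_pos m with rfl | hm0
    · exact hW.hasSign_neg_one_of_finrank_eq_two h (by omega)
    · obtain ⟨r, hr, hr0, hQr⟩ := hW.exists_isotropic (by omega)
      obtain ⟨s, hs, hrs, hQs⟩ := exists_hyperbolic_partner hW hr hr0 hQr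
      have h1 := finrank_perp_perp hr hs hQr hrs
      exact (hasSign_perp_perp_iff hr hs hQr hrs).1 (ih (hW.perp_perp hr hs hQr hQs hrs)
        (fun h' => h (hasHalfSingular_of_perp_perp hr hs hQr hrs h')) (by omega))

theorem NondegenerateOn.hasSign [Finite V] (hW : NondegenerateOn Q W) {m : ℕ}
    (hm : finrank (ZMod 3) W = 2 * m) : HasSign Q W m 1 ∨ HasSign Q W m (-1) := by
  by_cases h : HasHalfSingular Q W
  · exact Or.inl (hW.hasSign_one h hm)
  · exact Or.inr (hW.hasSign_neg_one h hm)

theorem NondegenerateOn.hasHalfSingular_iff [Finite V] (hW : NondegenerateOn Q W) {m : ℕ}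
    (hm : finrank (ZMod 3) W = 2 * m) : HasHalfSingular Q W ↔ HasSign Q W m 1 := by
  refine ⟨fun h => hW.hasSign_one h hm, fun h => ?_⟩
  by_contra h'
  exact absurd (h.unique (hW.hasSign_neg_one h' hm)) (by norm_num)

theorem NondegenerateOn.not_hasHalfSingular_iff [Finite V] (hW : NondegenerateOn Q W) {m : ℕ}
    (hm : finrank (ZMod 3) W = 2 * m) : ¬ HasHalfSingular Q W ↔ HasSign Q W m (-1) := by
  refine ⟨fun h => hW.hasSign_neg_one h hm, fun h h' => ?_⟩
  exact absurd (h.unique (hW.hasSign_one h' hm)) (by norm_num)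

/-! ### Translation of the definitions for restricted forms -/

theorem nondegenerate_iff_forall_polar {E : Type*} [AddCommGroup E] [Module (ZMod 3) E]
    {q : QuadraticForm (ZMod 3) E} :
    q.Nondegenerate ↔ ∀ x, (∀ y, polar q x y = 0) → x = 0 := by
  let _ : Invertible (2 : ZMod 3) := ⟨2, by decide, by decide⟩
  rw [QuadraticMap.nondegenerate_iff_radical_eq_bot, QuadraticMap.radical_eq_ker_polarBilin,
    LinearMap.ker_eq_bot']
  refine forall_congr' fun x => ?_
  rw [LinearMap.ext_iff]
  rfl

theorem nondegenerateOn_top_iff : NondegenerateOn Q ⊤ ↔ Q.Nondegenerate := by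
  rw [nondegenerate_iff_forall_polar]
  simp [NondegenerateOn]

theorem nondegenerate_restrict_iff : (Q.restrict W).Nondegenerate ↔ NondegenerateOn Q W := by
  rw [nondegenerate_iff_forall_polar]
  simp only [Subtype.forall, NondegenerateOn, Submodule.mk_eq_zero]
  rfl

theorem hasHalfSingular_iff :
    (∃ U : Submodule (ZMod 3) W, IsTotallySingular (Q.restrict W) U ∧
      2 * finrank (ZMod 3) U = finrank (ZMod 3) W) ↔ HasHalfSingular Q W := by
  constructor
  · rintro ⟨U, hU, hd⟩
    refine ⟨U.map W.subtype, Submodule.map_subtype_le W U, ?_, ?_⟩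
    · rintro _ ⟨u, hu, rfl⟩
      exact hU u hu
    · rw [← hd, (Submodule.equivMapOfInjective W.subtype W.subtype_injective U).finrank_eq]
  · rintro ⟨U, hUW, hU, hd⟩
    refine ⟨U.comap W.subtype, fun u hu => hU u hu, ?_⟩
    rw [← hd, (Submodule.comapSubtypeEquivOfLe hUW).finrank_eq]

theorem isElliptic_restrict_iff [Finite V] {m : ℕ} (hm : finrank (ZMod 3) W = 2 * m) :
    IsElliptic (Q.restrict W) ↔ NondegenerateOn Q W ∧ HasSign Q W m (-1) := by
  rw [IsElliptic, hasHalfSingular_iff, nondegenerate_restrict_iff]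
  refine and_congr_right fun hW => ?_
  rw [hW.not_hasHalfSingular_iff hm, and_iff_right]
  exact hm ▸ even_two_mul m

theorem isHyperbolic_restrict_iff [Finite V] {m : ℕ} (hm : finrank (ZMod 3) W = 2 * m) :
    IsHyperbolic (Q.restrict W) ↔ NondegenerateOn Q W ∧ HasSign Q W m 1 := by
  rw [IsHyperbolic, hasHalfSingular_iff, nondegenerate_restrict_iff]
  exact and_congr_right fun hW => hW.hasHalfSingular_iff hm

/-! ### Hyperplanes as polar spaces -/

theorem exists_orthogonal [Finite V] {U : Submodule (ZMod 3) V}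
    (h : finrank (ZMod 3) U < finrank (ZMod 3) W) :
    ∃ e ∈ W, e ≠ 0 ∧ ∀ y ∈ U, polar Q e y = 0 := by
  let g : W →ₗ[ZMod 3] Module.Dual (ZMod 3) U :=
    (Submodule.subtype U).dualMap ∘ₗ Q.polarBilin ∘ₗ W.subtype
  have hg : LinearMap.ker g ≠ ⊥ :=
    LinearMap.ker_ne_bot_of_finrank_lt (by rwa [Subspace.dual_finrank_eq])
  obtain ⟨x, hx, hx0⟩ := (Submodule.ne_bot_iff _).1 hg
  refine ⟨x, x.2, by simpa using hx0, fun y hy => ?_⟩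
  exact LinearMap.congr_fun (LinearMap.mem_ker.1 hx) ⟨y, hy⟩

theorem NondegenerateOn.eq_perp [Finite V] (hW : NondegenerateOn Q W)
    {U : Submodule (ZMod 3) V} (hU : IsHyperplaneOf U W) {e : V} (he : e ∈ W) (he0 : e ≠ 0)
    (h : ∀ y ∈ U, polar Q e y = 0) : U = perp Q W e := by
  obtain ⟨y, hy, hey⟩ := hW.exists_polar_ne_zero he he0
  have h1 := finrank_perp hy hey
  refine Submodule.eq_of_le_of_finrank_eq (fun x hx => mem_perp.2 ⟨hU.1 hx, h x hx⟩) ?_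
  have h2 := hU.2
  omega

theorem NondegenerateOn.exists_eq_perp [Finite V] (hW : NondegenerateOn Q W)
    {U : Submodule (ZMod 3) V} (hU : IsHyperplaneOf U W) :
    ∃ e ∈ W, e ≠ 0 ∧ U = perp Q W e := by
  obtain ⟨e, he, he0, h⟩ := exists_orthogonal (Q := Q) (U := U) (W := W) (by have := hU.2; omega)
  exact ⟨e, he, he0, hW.eq_perp hU he he0 h⟩

theorem NondegenerateOn.isHyperplaneOf_perp [Finite V] (hW : NondegenerateOn Q W) {e : V}
    (he : e ∈ W) (he0 : e ≠ 0) : IsHyperplaneOf (perp Q W e) W := by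
  obtain ⟨y, hy, hey⟩ := hW.exists_polar_ne_zero he he0
  exact ⟨perp_le e, finrank_perp hy hey⟩

theorem not_nondegenerateOn_perp {e : V} (he : e ∈ W) (he0 : e ≠ 0) (hQ : Q e = 0) :
    ¬ NondegenerateOn Q (perp Q W e) := fun h =>
  he0 (h e (mem_perp.2 ⟨he, by rw [polar_self_eq, hQ, mul_zero]⟩) fun _ hy => (mem_perp.1 hy).2)

theorem NondegenerateOn.isSingularHyperplaneOf_iff [Finite V] (hW : NondegenerateOn Q W)
    {U : Submodule (ZMod 3) V} :
    IsSingularHyperplaneOf Q U W ↔ ∃ r ∈ W, r ≠ 0 ∧ Q r = 0 ∧ U = perp Q W r := by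
  rw [IsSingularHyperplaneOf, nondegenerate_restrict_iff]
  constructor
  · rintro ⟨hU, hdeg⟩
    obtain ⟨r, hr, hr0, rfl⟩ := hW.exists_eq_perp hU
    refine ⟨r, hr, hr0, ?_, rfl⟩
    by_contra hQ
    exact hdeg (hW.perp_of_ne_zero hr hQ)
  · rintro ⟨r, hr, hr0, hQ, rfl⟩
    exact ⟨hW.isHyperplaneOf_perp hr hr0, not_nondegenerateOn_perp hr hr0 hQ⟩

theorem polarSpace_eq (p : ℙ (ZMod 3) V) : polarSpace Q p = perp Q ⊤ p.rep := by
  rw [polarSpace, perp, top_inf_eq]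

/-! ### The signs of the hyperplanes -/

/-- Double counting: the vectors of V with value Q(u) are counted through V = ⟨u⟩ ⊥ u^⊥ and through
V = ⟨h⟩ ⊥ h^⊥. The two results agree only for the stated sign. -/
theorem HasSign.of_perp_of_perp [Finite V] {n : ℕ} {ε : ℤ} {u h : V} (hQu : Q u ≠ 0)
    (hu : HasSign Q (perp Q ⊤ u) n ε) (hQh : Q h ≠ 0) (hW : NondegenerateOn Q (⊤ : Submodule _ V)) :
    HasSign Q (perp Q ⊤ h) n (if Q h = Q u then ε else -ε) := by
  have d1 := finrank_perp_add_one (W := ⊤) (Q := Q) Submodule.mem_top hQu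
  have d2 := finrank_perp_add_one (W := ⊤) (Q := Q) Submodule.mem_top hQh
  have d3 := hu.1
  obtain ⟨ε', hh⟩ : ∃ ε', HasSign Q (perp Q ⊤ h) n ε' := by
    rcases (hW.perp_of_ne_zero Submodule.mem_top hQh).hasSign (m := n) (by omega) with h' | h'
    exacts [⟨_, h'⟩, ⟨_, h'⟩]
  have c1 := count_of_anisotropic (W := ⊤) (Q := Q) Submodule.mem_top hQu (Q u)
  have c2 := count_of_anisotropic (W := ⊤) (Q := Q) Submodule.mem_top hQh (Q u)
  rw [c1] at c2
  have k1 := hu.2 (Q u)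
  have k2 := hu.2 (Q u - Q u)
  have k3 := hh.2 (Q u)
  have k4 := hh.2 (Q u - Q h)
  rw [if_neg hQu] at k1 k3
  rw [if_pos (sub_self _)] at k2
  have hc : Q u - Q h = 0 ↔ Q h = Q u := by rw [sub_eq_zero, eq_comm]
  rw [if_congr hc rfl rfl] at k4
  have h3 : (3 : ℤ) ^ n ≠ 0 := by positivity
  have c3 : ((count Q (perp Q ⊤ u) (Q u) + 2 * count Q (perp Q ⊤ u) (Q u - Q u) : ℕ) : ℤ)
      = (count Q (perp Q ⊤ h) (Q u) + 2 * count Q (perp Q ⊤ h) (Q u - Q h) : ℕ) := by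
    rw [c2]
  push_cast at c3
  convert hh using 1
  split_ifs at k4 ⊢ with he
  · exact mul_right_cancel₀ h3 (by linarith)
  · exact mul_right_cancel₀ h3 (by linarith)

theorem card_subtype_and_add {α : Type*} [Finite α] (p q : α → Prop) :
    Nat.card {x // p x} = Nat.card {x // p x ∧ q x} + Nat.card {x // p x ∧ ¬ q x} := by
  classical
  rw [← Nat.card_sum]
  refine Nat.card_congr (((Equiv.sumCompl fun x : {x // p x} => q x).symm).trans
    (Equiv.sumCongr ?_ ?_))
  · exact Equiv.subtypeSubtypeEquivSubtypeInter p q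
  · exact Equiv.subtypeSubtypeEquivSubtypeInter p fun x => ¬ q x

/-- The sign of a value of `Q`, relative to the nonzero value `a`. -/
def relSign (a x : ZMod 3) : ℤ :=
  if x = 0 then 0 else if x = a then 1 else -1

theorem count_perp_top [Finite V] {n : ℕ} {ε : ℤ} {u h : V} (hQu : Q u ≠ 0)
    (hu : HasSign Q (perp Q ⊤ u) n ε) (hW : NondegenerateOn Q (⊤ : Submodule _ V)) (h0 : h ≠ 0) :
    3 * (count Q (perp Q ⊤ h) 0 : ℤ) = 9 ^ n + relSign (Q u) (Q h) * ε * (2 * 3 ^ n) := by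
  unfold relSign
  split_ifs with h1 h2
  · have d1 := finrank_perp_add_one (W := ⊤) (Q := Q) Submodule.mem_top hQu
    obtain ⟨y, hy, hhy⟩ := hW.exists_polar_ne_zero (r := h) Submodule.mem_top h0
    have d2 := finrank_perp hy hhy
    have c1 := count_of_isotropic (W := ⊤) Submodule.mem_top h1 hy hhy 0
    have c2 := count_of_anisotropic (W := ⊤) (Q := Q) Submodule.mem_top hQu 0
    have d3 := hu.1
    have d4 : finrank (ZMod 3) (perp Q ⊤ h) = 2 * n := by omega
    rw [c2, d4, pow_mul] at c1
    have k1 := hu.2 0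
    have k2 := hu.2 (0 - Q u)
    rw [if_pos rfl] at k1
    rw [if_neg (by simpa using hQu)] at k2
    zify at c1
    rw [show (3 : ℤ) ^ 2 = 9 by norm_num] at c1
    linarith
  · have := (hu.of_perp_of_perp hQu h1 hW).2 0
    rw [if_pos h2, if_pos rfl] at this
    linarith
  · have := (hu.of_perp_of_perp hQu h1 hW).2 0
    rw [if_neg h2, if_pos rfl] at this
    linarith

theorem perp_smul (e : V) {t : ZMod 3} (ht : t ≠ 0) : perp Q W (t • e) = perp Q W e := by
  rw [perp, map_smul, LinearMap.ker_smul _ _ ht, perp]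

/-! ### The switched cone -/

/-- The vectors representing the points of the switched set: in the part of `u^⊥` not orthogonal
to `r`, the value `0` of `Q` is replaced with the value `Q u`. -/
def SwitchedCone (Q : QuadraticForm (ZMod 3) V) (u r x : V) : Prop :=
  (polar Q u x = 0 ∧ polar Q r x ≠ 0 → Q x = Q u) ∧
    (¬ (polar Q u x = 0 ∧ polar Q r x ≠ 0) → Q x = 0)

/-- The number of vectors of the switched cone in `W`. -/
noncomputable def switchedCount (Q : QuadraticForm (ZMod 3) V) (u r : V)
    (W : Submodule (ZMod 3) V) : ℕ :=
  Nat.card {x : V // x ∈ W ∧ SwitchedCone Q u r x}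

theorem card_off_eq [Finite V] (r : V) (c : ZMod 3) :
    Nat.card {x : V // (x ∈ W ∧ Q x = c) ∧ polar Q r x ≠ 0} =
      countFiber Q W (Q.polarBilin r) 1 c + countFiber Q W (Q.polarBilin r) 2 c := by
  have h1 := card_subtype_and_add (fun x => x ∈ W ∧ Q x = c) (fun x => polar Q r x = 0)
  have h2 := count_eq_sum_countFiber (Q := Q) (W := W) (Q.polarBilin r) c
  have h3 : countFiber Q W (Q.polarBilin r) 0 c
      = Nat.card {x : V // (x ∈ W ∧ Q x = c) ∧ polar Q r x = 0} :=
    Nat.card_congr (Equiv.subtypeEquivRight fun x => by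
      rw [QuadraticMap.polarBilin_apply_apply]; tauto)
  change count Q W c = _ at h1
  simp only [ne_eq]
  omega

/-- Balance of vectors removed and added, written additively to avoid subtraction in ℕ. The two
fibres 1 and 2 make up the part of W ∩ u^⊥ off r^⊥. -/
theorem switchedCount_add [Finite V] (u r : V) :
    switchedCount Q u r W + (countFiber Q (perp Q W u) (Q.polarBilin r) 1 0
        + countFiber Q (perp Q W u) (Q.polarBilin r) 2 0) =
      count Q W 0 + (countFiber Q (perp Q W u) (Q.polarBilin r) 1 (Q u)
        + countFiber Q (perp Q W u) (Q.polarBilin r) 2 (Q u)) := by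
  rw [← card_off_eq, ← card_off_eq, switchedCount, count,
    card_subtype_and_add (fun x => x ∈ W ∧ SwitchedCone Q u r x)
      (fun x => polar Q u x = 0 ∧ polar Q r x ≠ 0),
    card_subtype_and_add (fun x => x ∈ W ∧ Q x = 0)
      (fun x => polar Q u x = 0 ∧ polar Q r x ≠ 0)]
  have e1 : Nat.card {x : V // (x ∈ W ∧ SwitchedCone Q u r x) ∧ polar Q u x = 0 ∧ polar Q r x ≠ 0}
      = Nat.card {x : V // (x ∈ perp Q W u ∧ Q x = Q u) ∧ polar Q r x ≠ 0} :=
    Nat.card_congr (Equiv.subtypeEquivRight fun x => by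
      rw [mem_perp, SwitchedCone]; tauto)
  have e2 : Nat.card {x : V // (x ∈ W ∧ Q x = 0) ∧ polar Q u x = 0 ∧ polar Q r x ≠ 0}
      = Nat.card {x : V // (x ∈ perp Q W u ∧ Q x = 0) ∧ polar Q r x ≠ 0} :=
    Nat.card_congr (Equiv.subtypeEquivRight fun x => by
      rw [mem_perp]; tauto)
  have e3 : Nat.card {x : V // (x ∈ W ∧ SwitchedCone Q u r x) ∧
        ¬ (polar Q u x = 0 ∧ polar Q r x ≠ 0)}
      = Nat.card {x : V // (x ∈ W ∧ Q x = 0) ∧ ¬ (polar Q u x = 0 ∧ polar Q r x ≠ 0)} :=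
    Nat.card_congr (Equiv.subtypeEquivRight fun x => by
      rw [SwitchedCone]; tauto)
  rw [e1, e2, e3]
  omega

/-- Hyperplanes through the vertex of the singular section are not affected by the switching. -/
theorem switchedCount_eq_count [Finite V] {u r : V} (hru : polar Q u r = 0) (hQr : Q r = 0)
    (hr : r ∈ W) : switchedCount Q u r W = count Q W 0 := by
  have h1 := switchedCount_add (Q := Q) (W := W) u r
  have hr' : r ∈ perp Q W u := mem_perp.2 ⟨hr, hru⟩
  rw [countFiber_isotropic hr' hQr (by decide : (1 : ZMod 3) ≠ 0) (Q u) 0,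
    countFiber_isotropic hr' hQr (by decide : (2 : ZMod 3) ≠ 0) (Q u) 0] at h1
  omega

/-- With s the projection of h to u^⊥ and b = Q(s), the space T = u^⊥ ∩ h^⊥ is M ⊥ ⟨e⟩ with Q(e) =
-b, where M has sign ε and dimension 2m. Off M, the value c is therefore taken 2 · count M (c + b)
times; the change is the difference for c = Q(u) and c = 0. -/
theorem switchedCount_of_polar_eq_one [Finite V] {m : ℕ} {ε : ℤ} {u r h : V}
    (hQu : Q u ≠ 0) (hu : HasSign Q (perp Q ⊤ u) (m + 1) ε) (hru : polar Q u r = 0)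
    (hQr : Q r = 0) (hrh : polar Q r h = 1) :
    ∃ b, Q h = b + Q u * (polar Q u h * polar Q u h) ∧
      3 * (switchedCount Q u r (perp Q ⊤ h) : ℤ) = 3 * count Q (perp Q ⊤ h) 0
        + 2 * (ε * 3 ^ m *
          ((if Q u + b = 0 then 2 else -1) - (if b = 0 then 2 else -1))) := by
  have haa := mul_self_of_ne_zero hQu
  set s := h + (Q u * polar Q u h) • u with hs
  have hus : polar Q u s = 0 := by
    rw [hs, polar_add_smul, polar_self_eq]
    revert hQu
    generalize Q u = a
    generalize polar Q u h = p
    clear * -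
    decide +revert
  have hrs : polar Q r s = 1 := by
    rw [hs, polar_add_smul, hrh, QuadraticMap.polar_comm Q r u, hru]; ring
  have hsx : ∀ x, polar Q u x = 0 → polar Q s x = polar Q h x := fun x hx => by
    rw [QuadraticMap.polar_comm Q s x, hs, polar_add_smul, QuadraticMap.polar_comm Q x u, hx,
      QuadraticMap.polar_comm Q x h]
    ring
  have hQs : Q h = Q s + Q u * (polar Q u h * polar Q u h) := by
    rw [hs, map_add_smul, QuadraticMap.polar_comm Q h u]
    revert hQu
    generalize Q u = a
    generalize polar Q u h = p
    generalize Q h = q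
    clear * -
    decide +revert
  generalize hb : Q s = b at *
  have hs0r : polar Q r (s + (-b) • r) = 1 := by
    rw [polar_add_smul, polar_self_eq, hQr, hrs]; ring
  have hsr : polar Q s r = 1 := by rw [QuadraticMap.polar_comm, hrs]
  have hr : r ∈ perp Q ⊤ u := mem_perp.2 ⟨Submodule.mem_top, hru⟩
  have hs0 : s + (-b) • r ∈ perp Q ⊤ u :=
    mem_perp.2 ⟨Submodule.mem_top, by rw [polar_add_smul, hus, hru]; ring⟩
  have hM := (hasSign_perp_perp_iff hr hs0 hQr hs0r).2 hu
  -- Since B(s,e) = 2b + b = 0, e lies in T; its partner s - b r is singular and forms a hyperbolic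
  -- pair with r, whose orthogonal space in u^⊥ is M.
  set e := s + b • r with he
  set T := perp Q (perp Q ⊤ h) u with hT
  have heT : e ∈ T := by
    rw [hT, mem_perp, mem_perp, ← hsx _ (by rw [he, polar_add_smul, hus, hru]; ring)]
    refine ⟨⟨Submodule.mem_top, ?_⟩, ?_⟩
    · rw [he, polar_add_smul, polar_self_eq, hsr, hb]
      clear * -
      decide +revert
    · rw [he, polar_add_smul, hus, hru]; ring
  have hre : Q.polarBilin r e = 1 := by
    rw [QuadraticMap.polarBilin_apply_apply, he, polar_add_smul, polar_self_eq, hQr, hrs]; ring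
  have hQe : Q e = -b := by
    rw [he, map_add_smul, hQr, hsr, hb]
    clear * -
    decide +revert
  have horth : ∀ x ∈ T, Q.polarBilin r x = 0 → polar Q x e = 0 := by
    intro x hx hrx
    rw [QuadraticMap.polarBilin_apply_apply] at hrx
    rw [hT, mem_perp, mem_perp] at hx
    rw [he, polar_add_smul, QuadraticMap.polar_comm Q x s, hsx x hx.2, hx.1.2,
      QuadraticMap.polar_comm Q x r, hrx]
    ring
  have hker : T ⊓ LinearMap.ker (Q.polarBilin r) =
      perp Q (perp Q (perp Q ⊤ u) r) (s + (-b) • r) := by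
    ext x
    rw [Submodule.mem_inf, LinearMap.mem_ker, QuadraticMap.polarBilin_apply_apply, hT, mem_perp,
      mem_perp, mem_perp, mem_perp, mem_perp, QuadraticMap.polar_comm Q (s + (-b) • r) x,
      polar_add_smul, QuadraticMap.polar_comm Q x s, QuadraticMap.polar_comm Q x r]
    constructor
    · rintro ⟨⟨⟨_, h1⟩, h2⟩, h3⟩
      refine ⟨⟨⟨Submodule.mem_top, h2⟩, h3⟩, ?_⟩
      rw [hsx x h2, h1, h3]; ring
    · rintro ⟨⟨⟨_, h2⟩, h3⟩, h4⟩
      rw [h3, mul_zero, add_zero, hsx x h2] at h4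
      exact ⟨⟨⟨Submodule.mem_top, h4⟩, h2⟩, h3⟩
  refine ⟨b, hQs, ?_⟩
  have key := switchedCount_add (Q := Q) (W := perp Q ⊤ h) u r
  rw [← hT, countFiber_eq heT hre horth, countFiber_eq heT hre horth, countFiber_eq heT hre horth,
    countFiber_eq heT hre horth, hker, hQe] at key
  have e1 : (0 : ZMod 3) - 1 * 1 * -b = b := by ring
  have e2 : (0 : ZMod 3) - 2 * 2 * -b = b := by clear * -; decide +revert
  have e3 : Q u - 1 * 1 * -b = Q u + b := by ring
  have e4 : Q u - 2 * 2 * -b = Q u + b := by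
    generalize Q u = a
    clear * -
    decide +revert
  rw [e1, e2, e3, e4] at key
  have k1 := hM.2 b
  have k2 := hM.2 (Q u + b)
  zify at key
  generalize (if b = 0 then (2 : ℤ) else -1) = d1 at *
  generalize (if Q u + b = 0 then (2 : ℤ) else -1) = d2 at *
  linear_combination 3 * key + 2 * k2 - 2 * k1

theorem switchedCount_perp_top [Finite V] {n : ℕ} {ε : ℤ} {u r h : V} (hn : n ≠ 0)
    (hQu : Q u ≠ 0) (hu : HasSign Q (perp Q ⊤ u) n ε)
    (hW : NondegenerateOn Q (⊤ : Submodule _ V)) (hru : polar Q u r = 0)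
    (hQr : Q r = 0) (h0 : h ≠ 0) :
    ∃ σ : ℤ, (σ = 0 ∨ σ = 1 ∨ σ = -1) ∧
      3 * (switchedCount Q u r (perp Q ⊤ h) : ℤ) = 9 ^ n + σ * ε * (2 * 3 ^ n) ∧
      (polar Q r h = 0 → σ = relSign (Q u) (Q h)) ∧
      (polar Q r h ≠ 0 → polar Q u h = 0 → Q h = 0 → σ = -1) := by
  have hcount := count_perp_top hQu hu hW h0
  by_cases hrh : polar Q r h = 0
  · refine ⟨relSign (Q u) (Q h), ?_, ?_, fun _ => rfl, fun h' => absurd hrh h'⟩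
    · unfold relSign
      split_ifs <;> simp
    · rw [switchedCount_eq_count hru hQr
        (mem_perp.2 ⟨Submodule.mem_top, by rw [QuadraticMap.polar_comm, hrh]⟩), hcount]
  · obtain ⟨m, rfl⟩ := Nat.exists_eq_succ_of_ne_zero hn
    have hh : polar Q r (polar Q r h • h) = 1 := by
      rw [QuadraticMap.polar_smul_right, smul_eq_mul, mul_self_of_ne_zero hrh]
    obtain ⟨b, hb, key⟩ := switchedCount_of_polar_eq_one hQu hu hru hQr hh
    rw [perp_smul h hrh, hcount] at key
    rw [QuadraticMap.map_smul, QuadraticMap.polar_smul_right, smul_eq_mul, smul_eq_mul,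
      mul_self_of_ne_zero hrh, one_mul, mul_mul_mul_comm, mul_self_of_ne_zero hrh, one_mul] at hb
    -- The correction has factor 2ε3^m while σ enters with 2ε3^(m+1), whence the coefficient 3.
    obtain ⟨σ, h1, h2, h3⟩ : ∃ σ : ℤ, (σ = 0 ∨ σ = 1 ∨ σ = -1) ∧
        (3 * σ = 3 * relSign (Q u) (Q h) +
          ((if Q u + b = 0 then 2 else -1) - (if b = 0 then 2 else -1))) ∧
        (polar Q u h = 0 → Q h = 0 → σ = -1) := by
      rw [hb]
      revert hQu
      generalize Q u = a
      generalize polar Q u h = p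
      clear * -
      -- Encoding σ as i - 1 with i in `Fin 3` makes the existence claim decidable.
      have : ∀ a : ZMod 3, a ≠ 0 → ∀ p b : ZMod 3, ∃ i : Fin 3,
          (3 * ((i : ℤ) - 1) = 3 * relSign a (b + a * (p * p)) +
          ((if a + b = 0 then 2 else -1) - (if b = 0 then 2 else -1))) ∧
          (p = 0 → b + a * (p * p) = 0 → ((i : ℤ) - 1) = -1) := by
        unfold relSign
        decide
      intro ha
      obtain ⟨i, h1, h2⟩ := this a ha p b
      refine ⟨_, ?_, h1, h2⟩
      clear * -
      decide +revert
    refine ⟨σ, h1, ?_, fun h' => absurd h' hrh, fun _ => h3⟩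
    rw [key, Nat.succ_eq_add_one, pow_succ (3 : ℤ)]
    linear_combination (-2) * ε * 3 ^ m * h2

/-! ### Points and vectors -/

theorem mem_pointsOf {p : ℙ (ZMod 3) V} : p ∈ pointsOf W ↔ p.rep ∈ W := by
  rw [pointsOf, Set.mem_ofPred_eq, Projectivization.submodule_eq,
    Submodule.span_singleton_le_iff_mem]

theorem units_smul_iff {G : V → Prop} (hG : ∀ x, G x → G (-x)) (t : (ZMod 3)ˣ) (x : V) :
    G (t • x) ↔ G x := by
  have ht : t = 1 ∨ t = -1 := by
    revert t
    decide
  rcases ht with rfl | rfl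
  · rw [one_smul]
  · rw [Units.neg_smul, one_smul]
    exact ⟨fun h => by simpa using hG _ h, hG x⟩

theorem card_points [Finite V] {G : V → Prop} (hG : ∀ x, G x → G (-x)) :
    Nat.card {p : ℙ (ZMod 3) V // G p.rep} * 2 = Nat.card {x : V // x ≠ 0 ∧ G x} := by
  have h2 : Nat.card (ZMod 3)ˣ = 2 := by
    rw [Nat.card_eq_fintype_card]
    decide
  rw [← h2, ← Nat.card_prod]
  refine Nat.card_eq_of_bijective (fun y : {p : ℙ (ZMod 3) V // G p.rep} × (ZMod 3)ˣ =>
    (⟨y.2 • y.1.1.rep, (smul_ne_zero_iff_ne y.2).2 y.1.1.rep_nonzero,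
      (units_smul_iff hG _ _).2 y.1.2⟩ : {x : V // x ≠ 0 ∧ G x})) ⟨?_, ?_⟩
  · rintro ⟨⟨p, hp⟩, t⟩ ⟨⟨q, hq⟩, k⟩ h
    have h1 : t • p.rep = k • q.rep := congrArg Subtype.val h
    have hpq : p = q := by
      rw [← p.mk_rep, ← q.mk_rep, Projectivization.mk_eq_mk_iff]
      exact ⟨t⁻¹ * k, by rw [mul_smul, ← h1, inv_smul_smul]⟩
    subst hpq
    have htk : t = k := by
      have h3 : ((t : ZMod 3) - k) • p.rep = 0 := by
        rw [sub_smul, sub_eq_zero]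
        exact h1
      rcases smul_eq_zero.1 h3 with h4 | h4
      · exact Units.ext (sub_eq_zero.1 h4)
      · exact absurd h4 p.rep_nonzero
    rw [htk]
  · rintro ⟨x, hx, hGx⟩
    obtain ⟨a, ha⟩ := Projectivization.exists_smul_eq_mk_rep (ZMod 3) x hx
    refine ⟨⟨⟨Projectivization.mk (ZMod 3) x hx, ?_⟩, a⁻¹⟩, ?_⟩
    · rw [← ha]
      exact (units_smul_iff hG _ _).2 hGx
    · refine Subtype.ext ?_
      change a⁻¹ • (Projectivization.mk (ZMod 3) x hx).rep = x
      rw [← ha, inv_smul_smul]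

/-- Each point has two representing vectors ±x; the extra 1 is the zero vector. -/
theorem ncard_inter_pointsOf [Finite V] {F : V → Prop} (hF : ∀ x, F x → F (-x)) (hF0 : F 0)
    (H : Submodule (ZMod 3) V) :
    2 * ({p : ℙ (ZMod 3) V | F p.rep} ∩ pointsOf H).ncard + 1 =
      Nat.card {x : V // x ∈ H ∧ F x} := by
  have h1 := card_points (G := fun x => x ∈ H ∧ F x)
    (fun x hx => ⟨H.neg_mem hx.1, hF x hx.2⟩)
  have h2 := card_subtype_and_add (fun x => x ∈ H ∧ F x) (fun x => x = 0)
  have h3 : Nat.card {x : V // (x ∈ H ∧ F x) ∧ x = 0} = 1 := by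
    have : Unique {x : V // (x ∈ H ∧ F x) ∧ x = 0} :=
      ⟨⟨⟨0, ⟨H.zero_mem, hF0⟩, rfl⟩⟩, fun x => Subtype.ext x.2.2⟩
    exact Nat.card_unique
  have h4 : Nat.card {x : V // (x ∈ H ∧ F x) ∧ ¬ x = 0}
      = Nat.card {x : V // x ≠ 0 ∧ x ∈ H ∧ F x} :=
    Nat.card_congr (Equiv.subtypeEquivRight fun x => by tauto)
  have h5 : ({p : ℙ (ZMod 3) V | F p.rep} ∩ pointsOf H).ncard
      = Nat.card {p : ℙ (ZMod 3) V // p.rep ∈ H ∧ F p.rep} :=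
    Nat.card_congr (Equiv.subtypeEquivRight fun p => by
      rw [Set.mem_inter_iff, mem_pointsOf, Set.mem_ofPred_eq, and_comm])
  omega

theorem mem_hyperplaneSizes_iff [Finite V] (hW : NondegenerateOn Q (⊤ : Submodule _ V))
    {F : V → Prop} (hF : ∀ x, F x → F (-x)) (hF0 : F 0) {k : ℕ} :
    k ∈ hyperplaneSizes {p : ℙ (ZMod 3) V | F p.rep} ↔
      ∃ h : V, h ≠ 0 ∧ 2 * k + 1 = Nat.card {x : V // x ∈ perp Q ⊤ h ∧ F x} := by
  constructor
  · rintro ⟨H, hH, rfl⟩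
    obtain ⟨h, -, h0, rfl⟩ := hW.exists_eq_perp hH
    exact ⟨h, h0, ncard_inter_pointsOf hF hF0 _⟩
  · rintro ⟨h, h0, hk⟩
    refine ⟨perp Q ⊤ h, hW.isHyperplaneOf_perp Submodule.mem_top h0, ?_⟩
    rw [← ncard_inter_pointsOf hF hF0] at hk
    omega

theorem SwitchedCone.neg {u r x : V} (h : SwitchedCone Q u r x) : SwitchedCone Q u r (-x) := by
  simpa only [SwitchedCone, QuadraticMap.map_neg, QuadraticMap.polar_neg_right, neg_eq_zero,
    ne_eq] using h

theorem switchedCone_zero (u r : V) : SwitchedCone Q u r 0 := by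
  simp [SwitchedCone]

theorem hyperplaneSizes_switched [Finite V] {n : ℕ} {ε : ℤ} {u r : V} (hn : 2 ≤ n)
    (hQu : Q u ≠ 0) (hu : HasSign Q (perp Q ⊤ u) n ε)
    (hW : NondegenerateOn Q (⊤ : Submodule _ V)) (hru : polar Q u r = 0)
    (hQr : Q r = 0) (hr0 : r ≠ 0) :
    hyperplaneSizes {p : ℙ (ZMod 3) V | SwitchedCone Q u r p.rep} = hyperplaneSizes (quadric Q) := by
  have hd := finrank_perp_add_one (W := ⊤) (Q := Q) Submodule.mem_top hQu
  have hd1 := hu.1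
  ext k
  rw [mem_hyperplaneSizes_iff hW (F := SwitchedCone Q u r) (fun _ => SwitchedCone.neg)
    (switchedCone_zero u r), quadric,
    mem_hyperplaneSizes_iff hW (F := fun x => Q x = 0) (fun x hx => by
      rw [QuadraticMap.map_neg, hx]) (QuadraticMap.map_zero Q)]
  have hneg : -Q u ≠ 0 ∧ -Q u ≠ Q u := by
    revert hQu
    generalize Q u = a
    clear * -
    decide +revert
  constructor
  · rintro ⟨h, h0, hk⟩
    obtain ⟨σ, hσ, hc, -⟩ := switchedCount_perp_top (by omega) hQu hu hW hru hQr h0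
    -- Since Q takes every value c on nonzero vectors, some hyperplane meets the original quadric in
    -- the size given by σ.
    obtain ⟨c, hcσ⟩ : ∃ c, relSign (Q u) c = σ := by
      rcases hσ with rfl | rfl | rfl
      · exact ⟨0, by simp [relSign]⟩
      · exact ⟨Q u, by simp [relSign, hQu]⟩
      · exact ⟨-Q u, by simp [relSign, hneg.1, hneg.2]⟩
    obtain ⟨x, -, hx0, hQx⟩ := hW.exists_map_eq (by omega) c
    refine ⟨x, hx0, hk.trans ?_⟩
    have h1 := count_perp_top hQu hu hW hx0
    rw [hQx, hcσ, ← hc] at h1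
    have h2 : count Q (perp Q ⊤ x) 0 = switchedCount Q u r (perp Q ⊤ h) := by omega
    exact h2.symm
  · rintro ⟨h, h0, hk⟩
    have h1 := count_perp_top hQu hu hW h0
    suffices ∃ x : V, x ≠ 0 ∧ 3 * (switchedCount Q u r (perp Q ⊤ x) : ℤ)
        = 9 ^ n + relSign (Q u) (Q h) * ε * (2 * 3 ^ n) by
      obtain ⟨x, hx0, hx⟩ := this
      refine ⟨x, hx0, hk.trans ?_⟩
      have h2 : count Q (perp Q ⊤ h) 0 = switchedCount Q u r (perp Q ⊤ x) := by omega
      exact h2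
    by_cases hQh : Q h = 0
    · obtain ⟨σ, -, hc, hσ, -⟩ := switchedCount_perp_top (by omega) hQu hu hW hru hQr hr0
      refine ⟨r, hr0, ?_⟩
      rw [hc, hσ (by rw [polar_self_eq, hQr, mul_zero]), hQr, hQh]
    by_cases hQh' : Q h = Q u
    · have hu0 : u ≠ 0 := by
        rintro rfl
        exact hQu (QuadraticMap.map_zero Q)
      obtain ⟨σ, -, hc, hσ, -⟩ := switchedCount_perp_top (by omega) hQu hu hW hru hQr hu0
      refine ⟨u, hu0, ?_⟩
      rw [hc, hσ (by rw [QuadraticMap.polar_comm, hru]), hQh']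
    -- For the remaining sign -1 the witness is s^⊥, with s a hyperbolic partner of r in u^⊥: it is
    -- tangent to the quadric, but switching turns its relative sign 0 into -1.
    · have hξ := hW.perp_of_ne_zero Submodule.mem_top hQu
      obtain ⟨s, hs, hrs, hQs⟩ := exists_hyperbolic_partner hξ
        (mem_perp.2 ⟨Submodule.mem_top, hru⟩) hr0 hQr
      have hs0 : s ≠ 0 := by
        rintro rfl
        simp at hrs
      obtain ⟨σ, -, hc, -, hσ⟩ := switchedCount_perp_top (by omega) hQu hu hW hru hQr hs0
      refine ⟨s, hs0, ?_⟩
      rw [hc, hσ (by rw [hrs]; decide) (mem_perp.1 hs).2 hQs, relSign, if_neg hQh, if_neg hQh']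

/-! ### The switched set is not a quadric -/

theorem mem_quadric_mk {q : QuadraticForm (ZMod 3) V} {x : V} (hx : x ≠ 0) :
    (Projectivization.mk (ZMod 3) x hx) ∈ quadric q ↔ q x = 0 := by
  obtain ⟨a, ha⟩ := Projectivization.exists_smul_eq_mk_rep (ZMod 3) x hx
  rw [quadric, Set.mem_ofPred_eq, ← ha]
  exact units_smul_iff (G := fun x => q x = 0) (fun x hx => by rw [QuadraticMap.map_neg, hx]) a x

theorem map_eq_zero_iff_of_quadric_eq {q : QuadraticForm (ZMod 3) V} {F : V → Prop}
    (hF : ∀ x, F x → F (-x)) (h : {p : ℙ (ZMod 3) V | F p.rep} = quadric q) {x : V} (hx : x ≠ 0) :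
    q x = 0 ↔ F x := by
  obtain ⟨a, ha⟩ := Projectivization.exists_smul_eq_mk_rep (ZMod 3) x hx
  rw [← mem_quadric_mk hx, ← h, Set.mem_ofPred_eq, ← ha]
  exact units_smul_iff hF a x

theorem exists_orthogonal_pair_of_polar_ne_zero [Finite V] (hW : NondegenerateOn Q W)
    (h : 4 ≤ finrank (ZMod 3) W) {r : V} (hr : r ∈ W) (hr0 : r ≠ 0) (hQr : Q r = 0) {c : ZMod 3}
    (hc : c ≠ 0) :
    ∃ w ∈ W, ∃ w' ∈ W, Q w = c ∧ Q w' = c ∧ polar Q w w' = 0 ∧ polar Q r (w + w') ≠ 0 := by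
  obtain ⟨y, hy, hry⟩ := hW.exists_polar_ne_zero hr hr0
  obtain ⟨w, hw, hrw, hQw⟩ := exists_polar_eq_one_map_eq hr hQr hy hry c
  have hQw0 : Q w ≠ 0 := by rwa [hQw]
  have hd := finrank_perp_add_one hw hQw0
  obtain ⟨w', hw', -, hQw'⟩ := (hW.perp_of_ne_zero hw hQw0).exists_map_eq (by omega) c
  rw [mem_perp] at hw'
  by_cases h1 : polar Q r (w + w') = 0
  -- If B(r,w') = -1, then w' is replaced with -w', and B(r, w - w') = 2.
  · refine ⟨w, hw, -w', W.neg_mem hw'.1, hQw, by rw [QuadraticMap.map_neg, hQw'],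
      by rw [QuadraticMap.polar_neg_right, hw'.2, neg_zero], ?_⟩
    rw [QuadraticMap.polar_add_right, hrw] at h1
    rw [QuadraticMap.polar_add_right, QuadraticMap.polar_neg_right, hrw]
    revert h1
    generalize polar Q r w' = t
    clear * -
    decide +revert
  · exact ⟨w, hw, w', hw'.1, hQw, hQw', hw'.2, h1⟩

theorem not_isQuadric_switched [Finite V] {u r : V}
    (hd : 5 ≤ finrank (ZMod 3) V) (hQu : Q u ≠ 0)
    (hW : NondegenerateOn Q (⊤ : Submodule _ V)) (hru : polar Q u r = 0)
    (hQr : Q r = 0) (hr0 : r ≠ 0) :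
    ¬ IsQuadric {p : ℙ (ZMod 3) V | SwitchedCone Q u r p.rep} := by
  rintro ⟨q, -, hq⟩
  have hiff : ∀ x : V, x ≠ 0 → (q x = 0 ↔ SwitchedCone Q u r x) := fun x hx =>
    map_eq_zero_iff_of_quadric_eq (F := SwitchedCone Q u r) (fun _ => SwitchedCone.neg) hq hx
  have hdim := finrank_perp_add_one (W := ⊤) (Q := Q) Submodule.mem_top hQu
  rw [finrank_top] at hdim
  obtain ⟨w, hw, w', hw', hQw, hQw', hww, hrw⟩ := exists_orthogonal_pair_of_polar_ne_zero
    (hW.perp_of_ne_zero Submodule.mem_top hQu) (by omega)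
    (mem_perp.2 ⟨Submodule.mem_top, hru⟩) hr0 hQr (neg_ne_zero.2 hQu)
  have huw := (mem_perp.1 hw).2
  have huw' := (mem_perp.1 hw').2
  have hru' : polar Q r u = 0 := by rw [QuadraticMap.polar_comm, hru]
  -- Here x and y are points of the quadric off u^⊥. Their sum w + w' lies in the switched part with
  -- value -2Q(u) = Q(u), hence in the new set; x - y is off u^⊥ with value -Q(u), hence not in it.
  set x := w + (1 : ZMod 3) • u with hx
  set y := w' + (-1 : ZMod 3) • u with hy
  have hux : polar Q u x = 2 * Q u := by rw [hx, polar_add_smul, huw, polar_self_eq]; ring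
  have huy : polar Q u y = -(2 * Q u) := by rw [hy, polar_add_smul, huw', polar_self_eq]; ring
  have h2u : 2 * Q u ≠ 0 := mul_ne_zero (by decide) hQu
  have hQx : Q x = 0 := by
    rw [hx, map_add_smul, QuadraticMap.polar_comm, huw, hQw]; ring
  have hQy : Q y = 0 := by
    rw [hy, map_add_smul, QuadraticMap.polar_comm, huw', hQw']; ring
  have hxy : x + y = w + w' := by rw [hx, hy]; module
  have hpxy : polar Q x y = Q u := by
    have h1 := QuadraticMap.map_add Q x y
    rw [hQx, hQy, hxy, QuadraticMap.map_add Q, hww, hQw, hQw'] at h1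
    revert h1
    generalize polar Q x y = t
    generalize Q u = a
    clear * -
    decide +revert
  have hne : ∀ z : V, polar Q u z ≠ 0 → z ≠ 0 := by
    rintro z hz rfl
    simp at hz
  have hoff : ∀ z : V, polar Q u z ≠ 0 → (q z = 0 ↔ Q z = 0) := fun z hz => by
    rw [hiff z (hne z hz), SwitchedCone]
    tauto
  have hqx := (hoff x (by rwa [hux])).2 hQx
  have hqy := (hoff y (by rwa [huy, neg_ne_zero])).2 hQy
  have hxy0 : x + y ≠ 0 := by
    rw [hxy]
    intro h0
    rw [h0] at hrw
    simp at hrw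
  have hqxy : q (x + y) = 0 := by
    rw [hiff _ hxy0, SwitchedCone]
    have h1 : polar Q u (x + y) = 0 := by rw [QuadraticMap.polar_add_right, hux, huy]; ring
    have h2 : polar Q r (x + y) ≠ 0 := by rwa [hxy]
    have h3 : Q (x + y) = Q u := by rw [QuadraticMap.map_add Q, hQx, hQy, hpxy]; ring
    exact ⟨fun _ => h3, fun h => absurd ⟨h1, h2⟩ h⟩
  rw [QuadraticMap.map_add q, hqx, hqy, zero_add, zero_add] at hqxy
  have hsub : polar Q u (x + (-1 : ZMod 3) • y) ≠ 0 := by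
    rw [polar_add_smul, hux, huy]
    revert hQu
    generalize Q u = a
    clear * -
    decide +revert
  have h4 : q (x + (-1 : ZMod 3) • y) = 0 := by
    rw [map_add_smul, hqx, hqy, hqxy]; ring
  rw [hoff _ hsub, map_add_smul, hQx, hQy, hpxy] at h4
  exact hQu (by simpa using h4)

/-! ### The switched set as a point set -/

theorem replaceOutside_eq {u r : V} {X : Set (ℙ (ZMod 3) V)}
    (hX : X = {p | Q p.rep = Q u}) :
    replaceOutside (quadric Q) X (perp Q ⊤ u) (perp Q (perp Q ⊤ u) r) =
      {p | SwitchedCone Q u r p.rep} := by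
  ext p
  simp only [replaceOutside, hX, quadric, Set.mem_union, Set.mem_sdiff, Set.mem_inter_iff,
    Set.mem_ofPred_eq, mem_pointsOf, mem_perp, Submodule.mem_top, SwitchedCone]
  tauto

theorem isSwitching_replaceOutside (S X : Set (ℙ (ZMod 3) V)) (ξ π : Submodule (ZMod 3) V) :
    IsSwitching ξ S (replaceOutside S X ξ π) := by
  refine ⟨S ∩ (pointsOf ξ \ pointsOf π), X ∩ (pointsOf ξ \ pointsOf π), fun p hp => ⟨hp.1, hp.2.1⟩,
    fun p hp => hp.2.1, ?_⟩
  rw [replaceOutside, Set.sdiff_self_inter]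

theorem switching_of_hasSign [Finite V] {n : ℕ} {ε : ℤ} {u : V} (hn : 2 ≤ n)
    (hQu : Q u ≠ 0) (hu : HasSign Q (perp Q ⊤ u) n ε)
    (hW : NondegenerateOn Q (⊤ : Submodule _ V)) {X : Set (ℙ (ZMod 3) V)}
    (hX : X = {p | Q p.rep = Q u}) :
    (∃ π, IsSingularHyperplaneOf Q π (perp Q ⊤ u)) ∧
      ∀ π, IsSingularHyperplaneOf Q π (perp Q ⊤ u) →
        ∀ P', P' = replaceOutside (quadric Q) X (perp Q ⊤ u) π →
          IsSwitching (perp Q ⊤ u) (quadric Q) P' ∧ IsParabolicQuasiQuadric P' ∧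
            ¬ IsQuadric P' := by
  have hξ := hW.perp_of_ne_zero Submodule.mem_top hQu
  have hd1 := hu.1
  have hd := finrank_perp_add_one (W := ⊤) (Q := Q) Submodule.mem_top hQu
  rw [finrank_top] at hd
  simp only [hξ.isSingularHyperplaneOf_iff]
  constructor
  · obtain ⟨r, hr, hr0, hQr⟩ := hξ.exists_isotropic (by omega)
    exact ⟨_, r, hr, hr0, hQr, rfl⟩
  · rintro π ⟨r, hr, hr0, hQr, rfl⟩ P' hP'
    have hru := (mem_perp.1 hr).2
    refine ⟨hP' ▸ isSwitching_replaceOutside _ _ _ _, ?_, ?_⟩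
    · refine ⟨by omega, ⟨n, by omega⟩, Q, nondegenerateOn_top_iff.1 hW, ?_⟩
      rw [hP', replaceOutside_eq hX, hyperplaneSizes_switched hn hQu hu hW hru hQr hr0]
    · rw [hP', replaceOutside_eq hX]
      exact not_isQuadric_switched (by omega) hQu hW hru hQr hr0

/-- Identifies the internal or external points with a level set of Q: F_3 has only two nonzero
values, and the sign of x^⊥ tells them apart. -/
theorem nondegenerateOn_and_hasSign_perp_iff [Finite V] {n : ℕ} {ε : ℤ} {u x : V} (hε : ε ≠ 0)
    (hQu : Q u ≠ 0) (hu : HasSign Q (perp Q ⊤ u) n ε)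
    (hW : NondegenerateOn Q (⊤ : Submodule _ V)) (hx : x ≠ 0) :
    NondegenerateOn Q (perp Q ⊤ x) ∧ HasSign Q (perp Q ⊤ x) n ε ↔ Q x = Q u := by
  constructor
  · rintro ⟨h1, h2⟩
    have hQx : Q x ≠ 0 := fun h0 => not_nondegenerateOn_perp Submodule.mem_top hx h0 h1
    by_contra h3
    have h4 := h2.unique (hu.of_perp_of_perp hQu hQx hW)
    rw [if_neg h3] at h4
    omega
  · intro h
    have hQx : Q x ≠ 0 := by rwa [h]
    have h4 := hu.of_perp_of_perp hQu hQx hW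
    rw [if_pos h] at h4
    exact ⟨hW.perp_of_ne_zero Submodule.mem_top hQx, h4⟩

theorem finrank_perp_top [Finite V] (hW : NondegenerateOn Q (⊤ : Submodule _ V)) {n : ℕ}
    (hd : finrank (ZMod 3) V = 2 * n + 1) {x : V} (hx : x ≠ 0) :
    finrank (ZMod 3) (perp Q ⊤ x) = 2 * n := by
  have h1 := (hW.isHyperplaneOf_perp (e := x) Submodule.mem_top hx).2
  rw [finrank_top] at h1
  omega

theorem isEllipticHyperplane_perp_iff [Finite V] (hW : NondegenerateOn Q (⊤ : Submodule _ V))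
    {n : ℕ} (hd : finrank (ZMod 3) V = 2 * n + 1) {x : V} (hx : x ≠ 0) :
    IsEllipticHyperplane Q (perp Q ⊤ x) ↔
      NondegenerateOn Q (perp Q ⊤ x) ∧ HasSign Q (perp Q ⊤ x) n (-1) := by
  rw [IsEllipticHyperplane, isElliptic_restrict_iff (finrank_perp_top hW hd hx)]
  exact and_iff_right (hW.isHyperplaneOf_perp Submodule.mem_top hx)

theorem isHyperbolicHyperplane_perp_iff [Finite V] (hW : NondegenerateOn Q (⊤ : Submodule _ V))
    {n : ℕ} (hd : finrank (ZMod 3) V = 2 * n + 1) {x : V} (hx : x ≠ 0) :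
    IsHyperbolicHyperplane Q (perp Q ⊤ x) ↔
      NondegenerateOn Q (perp Q ⊤ x) ∧ HasSign Q (perp Q ⊤ x) n 1 := by
  rw [IsHyperbolicHyperplane, isHyperbolic_restrict_iff (finrank_perp_top hW hd hx)]
  exact and_iff_right (hW.isHyperplaneOf_perp Submodule.mem_top hx)

/-- Hyperplanes of both signs exist. -/
theorem exists_hasSign [Finite V] (hW : NondegenerateOn Q (⊤ : Submodule _ V)) {n : ℕ}
    (hn : n ≠ 0) (hd : finrank (ZMod 3) V = 2 * n + 1) {ε : ℤ} (hε : ε = 1 ∨ ε = -1) :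
    ∃ x : V, x ≠ 0 ∧ NondegenerateOn Q (perp Q ⊤ x) ∧ HasSign Q (perp Q ⊤ x) n ε := by
  have hd' : 3 ≤ finrank (ZMod 3) (⊤ : Submodule (ZMod 3) V) := by
    rw [finrank_top]
    omega
  -- Vectors of values 1 and -1 have polar hyperplanes of opposite signs, so one of the two has sign
  -- ε.
  obtain ⟨x, -, hx0, hQx⟩ := hW.exists_map_eq hd' 1
  obtain ⟨y, -, hy0, hQy⟩ := hW.exists_map_eq hd' (-1)
  have hQx' : Q x ≠ 0 := by rw [hQx]; decide
  have hQy' : Q y ≠ 0 := by rw [hQy]; decide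
  have hx := hW.perp_of_ne_zero Submodule.mem_top hQx'
  have hy := hW.perp_of_ne_zero Submodule.mem_top hQy'
  obtain ⟨δ, hδ, hxs⟩ : ∃ δ : ℤ, (δ = 1 ∨ δ = -1) ∧ HasSign Q (perp Q ⊤ x) n δ := by
    rcases hx.hasSign (finrank_perp_top hW hd hx0) with h | h
    exacts [⟨_, Or.inl rfl, h⟩, ⟨_, Or.inr rfl, h⟩]
  have hys := hxs.of_perp_of_perp hQx' hQy' hW
  rw [if_neg (by rw [hQx, hQy]; decide)] at hys
  by_cases h : ε = δ
  · exact ⟨x, hx0, hx, h ▸ hxs⟩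
  · have h' : ε = -δ := by omega
    exact ⟨y, hy0, hy, h' ▸ hys⟩

end QuasiPolar

theorem mainTheorem12 (n : ℕ) (hn : 2 ≤ n)
    (Q : QuadraticForm (ZMod 3) (Fin (2 * n + 1) → ZMod 3)) (hQ : Q.Nondegenerate) :
    ((∃ ξ, QuasiPolar.IsEllipticHyperplane Q ξ) ∧
      ∀ ξ, QuasiPolar.IsEllipticHyperplane Q ξ →
        (∃ π, QuasiPolar.IsSingularHyperplaneOf Q π ξ) ∧
        ∀ π, QuasiPolar.IsSingularHyperplaneOf Q π ξ →
          ∀ P', P' = QuasiPolar.replaceOutside (QuasiPolar.quadric Q)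
              (QuasiPolar.internalPoints Q) ξ π →
            QuasiPolar.IsSwitching ξ (QuasiPolar.quadric Q) P' ∧
            QuasiPolar.IsParabolicQuasiQuadric P' ∧
            ¬ QuasiPolar.IsQuadric P') ∧
    ((∃ ξ, QuasiPolar.IsHyperbolicHyperplane Q ξ) ∧
      ∀ ξ, QuasiPolar.IsHyperbolicHyperplane Q ξ →
        (∃ π, QuasiPolar.IsSingularHyperplaneOf Q π ξ) ∧
        ∀ π, QuasiPolar.IsSingularHyperplaneOf Q π ξ →
          ∀ P', P' = QuasiPolar.replaceOutside (QuasiPolar.quadric Q)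
              (QuasiPolar.externalPoints Q) ξ π →
            QuasiPolar.IsSwitching ξ (QuasiPolar.quadric Q) P' ∧
            QuasiPolar.IsParabolicQuasiQuadric P' ∧
            ¬ QuasiPolar.IsQuadric P') := by
  have hW := QuasiPolar.nondegenerateOn_top_iff.2 hQ
  have hd : finrank (ZMod 3) (Fin (2 * n + 1) → ZMod 3) = 2 * n + 1 := by simp
  refine ⟨⟨?_, fun ξ hξ => ?_⟩, ?_, fun ξ hξ => ?_⟩
  · obtain ⟨x, hx0, hx⟩ := QuasiPolar.exists_hasSign hW (by omega) hd (Or.inr rfl)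
    exact ⟨_, (QuasiPolar.isEllipticHyperplane_perp_iff hW hd hx0).2 hx⟩
  · obtain ⟨u, -, hu0, rfl⟩ := hW.exists_eq_perp hξ.1
    obtain ⟨hu, hus⟩ := (QuasiPolar.isEllipticHyperplane_perp_iff hW hd hu0).1 hξ
    have hQu : Q u ≠ 0 := fun h0 =>
      QuasiPolar.not_nondegenerateOn_perp Submodule.mem_top hu0 h0 hu
    refine QuasiPolar.switching_of_hasSign hn hQu hus hW (Set.ext fun p => ?_)
    rw [QuasiPolar.internalPoints, Set.mem_ofPred_eq, QuasiPolar.polarSpace_eq,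
      QuasiPolar.isEllipticHyperplane_perp_iff hW hd p.rep_nonzero]
    exact QuasiPolar.nondegenerateOn_and_hasSign_perp_iff (by norm_num) hQu hus hW p.rep_nonzero
  · obtain ⟨x, hx0, hx⟩ := QuasiPolar.exists_hasSign hW (by omega) hd (Or.inl rfl)
    exact ⟨_, (QuasiPolar.isHyperbolicHyperplane_perp_iff hW hd hx0).2 hx⟩
  · obtain ⟨u, -, hu0, rfl⟩ := hW.exists_eq_perp hξ.1
    obtain ⟨hu, hus⟩ := (QuasiPolar.isHyperbolicHyperplane_perp_iff hW hd hu0).1 hξ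
    have hQu : Q u ≠ 0 := fun h0 =>
      QuasiPolar.not_nondegenerateOn_perp Submodule.mem_top hu0 h0 hu
    refine QuasiPolar.switching_of_hasSign hn hQu hus hW (Set.ext fun p => ?_)
    rw [QuasiPolar.externalPoints, Set.mem_ofPred_eq, QuasiPolar.polarSpace_eq,
      QuasiPolar.isHyperbolicHyperplane_perp_iff hW hd p.rep_nonzero]
    exact QuasiPolar.nondegenerateOn_and_hasSign_perp_iff (by norm_num) hQu hus hW p.rep_nonzero
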